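/- Work over $\mathbb{C}$. For power series $f=(f_1,\dots,f_n)\in (t\,\mathbb{C}[[t]])^n$, the *value semigroup* of $f$ is the set of $t$-adic orders of the nonzero elements of the image of $\mathbb{C}[[x_1,\dots,x_n]]\to\mathbb{C}[[t]]$, $x_i\mapsto f_i$; and $f$ has *ramification profile* $(k_1,\dots,k_n)$, where $0<k_1<\dots<k_n$, if $\{0,k_1,\dots,k_n\}$ is the set of orders of nonzero $\mathbb{C}$-linear combinations of $1,f_1,\dots,f_n$. A set $S\subseteq\mathbb{N}$ is the *value semigroup of a generic cusp* with this profile if all $f$ in some nonempty Zariski open subset (defined by the nonvanishing of a polynomial in finitely many of the coefficients of the $f_i$) of the space of all $f$ with the profile have value semigroup $S$. Let $M^n_d\subset\mathbb{C}^{(n+1)(d+1)}$ be the space of nondegenerate morphisms $\mathbb{P}^1\to\mathbb{P}^n$ of degree $d$, each identified with the coefficients of its $n+1$ parameterizing binary forms of degree $d$ (which have no common zero and are linearly independent). For $S\subsetneq\mathbb{N}$ with $g=\#(\mathbb{N}\setminus S)$ finite, let $M^n_{d,g;S}\subseteq M^n_d$ be the Severi variety of those morphisms that normalize a curve (of arithmetic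 genus $g$) with exactly one singular point, that point being a cusp, i.e. unibranch, with value semigroup $S$. **Theorem.** There is a function $D:\mathbb{N}\to\mathbb{N}$ such that the following holds for all positive integers $n\ge 4$ and $m>\frac{7}{6}n+\frac{26}{9}$. There is exactly one value semigroup $S_{\rm gen}$ of a generic cusp with ramification profile $(2m,2m+2,\dots,2m+2n-2)$; its complement in $\mathbb{N}$ is finite, of cardinality $g$ say; and for every $d\ge D(g)$ the codimension of $M^n_{d,g;S_{\rm gen}}$ in $M^n_d$ is strictly less than $(n-2)g$ (in particular $M^n_{d,g;S_{\rm gen}}$ is nonempty, the empty set having codimension $\infty$). -/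

import Mathlib

noncomputable section

namespace SeveriGen

/-! ### Value semigroups and ramification profiles of parameterized cusps -/

/-- The value set `v_t(φ(R) \ {0})` of the germ parameterized by `f = (f₁, …, fₙ)`, where
`φ : R = ℂ⟦x₁, …, xₙ⟧ → ℂ⟦t⟧` sends `x_i` to `f_i`. It is used only for germs at the origin, that
is, when all the `f_i` have zero constant term, so that the substitution makes sense. -/
def valueSemigroup {n : ℕ} (f : Fin n → PowerSeries ℂ) : Set ℕ :=
  {s | ∃ G : MvPowerSeries (Fin n) ℂ,
    PowerSeries.order (MvPowerSeries.subst f G : PowerSeries ℂ) = (s : ℕ∞)}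

/-- The vanishing orders at `t = 0` of the (nonzero) linear combinations of `1, f₁, …, fₙ`. -/
def vanishingOrders {n : ℕ} (f : Fin n → PowerSeries ℂ) : Set ℕ :=
  {s | ∃ (c₀ : ℂ) (c : Fin n → ℂ),
    PowerSeries.order (PowerSeries.C c₀ + ∑ i, c i • f i) = (s : ℕ∞)}

/-- `f` parameterizes a germ at the origin of `ℂⁿ` with ramification profile `k = (k₁, …, kₙ)`
(and `k₀ = 0`). -/
def HasRamificationProfile {n : ℕ} (f : Fin n → PowerSeries ℂ) (k : Fin n → ℕ) : Prop :=
  (∀ i, PowerSeries.constantCoeff (f i) = 0) ∧ vanishingOrders f = insert 0 (Set.range k)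

/-- The value at `f` of a polynomial `Q` in (finitely many of) the coefficients of an `n`-tuple of
power series; the variable `(i, j)` stands for the coefficient of `t ^ j` in `f_i`. -/
def evalCoeffs {n : ℕ} (Q : MvPolynomial (Fin n × ℕ) ℂ) (f : Fin n → PowerSeries ℂ) : ℂ :=
  MvPolynomial.eval (fun ij : Fin n × ℕ => PowerSeries.coeff ij.2 (f ij.1)) Q

/-- `S` is the value semigroup of a generic cusp with ramification profile `k`: all members of some
nonempty (basic) Zariski open subset of the space of germs with ramification profile `k` have value
semigroup `S`. -/
def IsGenericValueSemigroup {n : ℕ} (k : Fin n → ℕ) (S : Set ℕ) : Prop :=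
  ∃ Q : MvPolynomial (Fin n × ℕ) ℂ,
    (∃ f, HasRamificationProfile f k ∧ evalCoeffs Q f ≠ 0) ∧
    ∀ f, HasRamificationProfile f k → evalCoeffs Q f ≠ 0 → valueSemigroup f = S

/-- The profile `(2m, 2m + 2, …, 2m + 2n - 2)`. -/
def evenProfile (n m : ℕ) : Fin n → ℕ := fun i => 2 * m + 2 * (i : ℕ)

/-! ### Morphisms from the projective line to projective space -/

/-- Coefficients of `n + 1` binary forms of degree `d`. -/
abbrev Coeffs (n d : ℕ) : Type := Fin (n + 1) × Fin (d + 1) → ℂ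

/-- The forms `F_i(x, y) = ∑ j, a_{i,j} x ^ j y ^ (d - j)`, evaluated at `u = (x, y)` in a
`ℂ`-algebra. -/
def formEval {n d : ℕ} {A : Type} [CommRing A] [Algebra ℂ A] (a : Coeffs n d) (u : Fin 2 → A) :
    Fin (n + 1) → A :=
  fun i => ∑ j : Fin (d + 1), a (i, j) • (u 0 ^ (j : ℕ) * u 1 ^ (d - (j : ℕ)))

theorem formEval_smul {n d : ℕ} (a : Coeffs n d) (t : ℂ) (u : Fin 2 → ℂ) :
    formEval a (t • u) = t ^ d • formEval a u := by
  funext i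
  simp only [formEval, Pi.smul_apply, smul_eq_mul, Finset.mul_sum]
  refine Finset.sum_congr rfl fun j _ => ?_
  have h : t ^ d = t ^ (j : ℕ) * t ^ (d - (j : ℕ)) := by
    rw [← pow_add, Nat.add_sub_cancel' (Nat.lt_succ_iff.mp j.2)]
  rw [h, mul_pow, mul_pow]
  ring

/-- The forms have no common zero on the projective line. -/
def BasePointFree {n d : ℕ} (a : Coeffs n d) : Prop :=
  ∀ u : Fin 2 → ℂ, u ≠ 0 → formEval a u ≠ 0

/-- The space `M^n_d` of nondegenerate morphisms `ℙ¹ → ℙⁿ` of degree `d`, inside the affine space of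
coefficients: the forms have no common zero and are linearly independent (so that the image lies in
no hyperplane). -/
def morphismSpace (n d : ℕ) : Set (Coeffs n d) :=
  {a | BasePointFree a ∧ LinearIndependent ℂ (fun i j => a (i, j))}

/-- The map `ℙ¹ → ℙⁿ` defined by base point free forms. -/
def toProjMap {n d : ℕ} (a : Coeffs n d) (ha : BasePointFree a) :
    Projectivization ℂ (Fin 2 → ℂ) → Projectivization ℂ (Fin (n + 1) → ℂ) :=
  Projectivization.lift
    (fun u => Projectivization.mk ℂ (formEval a (u : Fin 2 → ℂ)) (ha u.1 u.2))
    (by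
      rintro ⟨u, hu⟩ ⟨v, hv⟩ t (rfl : u = t • v)
      exact (Projectivization.mk_eq_mk_iff' ℂ _ _ _ _).2 ⟨t ^ d, (formEval_smul a t v).symm⟩)

/-- The power series `F_i(u + t w)`: the homogeneous coordinates of the morphism near the point
`[u]`, in the local parameter `t` given by a direction `w` independent of `u`. -/
def expansion {n d : ℕ} (a : Coeffs n d) (u w : Fin 2 → ℂ) : Fin (n + 1) → PowerSeries ℂ :=
  formEval a (fun l => PowerSeries.C (u l) + w l • PowerSeries.X)

/-- The affine coordinates `F_i / F_j`, `i ≠ j`, centered at the image point. Meaningful when `F_j`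
has nonzero constant term. -/
def affineGerm {n : ℕ} (F : Fin (n + 1) → PowerSeries ℂ) (j : Fin (n + 1)) :
    Fin n → PowerSeries ℂ :=
  fun i => F (j.succAbove i) * (F j)⁻¹ -
    PowerSeries.C (PowerSeries.constantCoeff (F (j.succAbove i) * (F j)⁻¹))

/-- The branch of the morphism at `p ∈ ℙ¹` has value semigroup `S`, computed in a local parameter
at `p` and an affine chart around the image of `p` (the choices do not affect the semigroup). -/
def HasValueSemigroupAt {n d : ℕ} (a : Coeffs n d) (p : Projectivization ℂ (Fin 2 → ℂ))
    (S : Set ℕ) : Prop :=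
  ∃ (u w : Fin 2 → ℂ) (hu : u ≠ 0) (j : Fin (n + 1)),
    Projectivization.mk ℂ u hu = p ∧ LinearIndependent ℂ ![u, w] ∧ formEval a u j ≠ 0 ∧
    valueSemigroup (affineGerm (expansion a u w) j) = S

/-- The Severi variety `M^n_{d,g;S}`, `g = #(ℕ \ S)`: nondegenerate morphisms `ℙ¹ → ℙⁿ` of degree
`d` that normalize a curve with exactly one singular point, this point being a cusp (unibranch) with
value semigroup `S`. That is, the morphism is injective, its branch at some point `p` has value
semigroup `S ≠ ℕ`, and every other branch has value semigroup `ℕ` (is smooth). The arithmetic genus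
of the image is the delta-invariant `#(ℕ \ S)` of the cusp. -/
def severiVariety (n d : ℕ) (S : Set ℕ) : Set (Coeffs n d) :=
  {a | a ∈ morphismSpace n d ∧ S ≠ Set.univ ∧
    ∃ ha : BasePointFree a, Function.Injective (toProjMap a ha) ∧
      ∃ p, HasValueSemigroupAt a p S ∧ ∀ q, q ≠ p → HasValueSemigroupAt a q Set.univ}

/-! ### Codimension -/

/-- The codimension of `Y` in `X`, for subsets `Y ⊆ X` of an affine space: the codimension of the
Zariski closure of `Y` in that of `X`, i.e. the height of the ideal of `Y` in the coordinate ring of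
the closure of `X`. The codimension of the empty set is `⊤`. -/
def codimension {σ : Type} (X Y : Set (σ → ℂ)) : ℕ∞ :=
  ((MvPolynomial.vanishingIdeal ℂ Y).map
    (Ideal.Quotient.mk (MvPolynomial.vanishingIdeal ℂ X))).height

end SeveriGen

end

/-! The codimension is bounded above by counting ramification conditions, the genus `g` is bounded
below by counting polynomials of low degree, and the two bounds are compared.

Codimension. Put the cusp at `x = 0`. Gaussian elimination on the coefficient matrix of the forms,
with pivots in columns `0, k₁, …, kₙ`, turns the profile into `∑ (kᵢ - i)` equations, namely the
vanishing of certain minors (`exists_finset_pivotEquations`). By Krull's height theorem this number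
bounds the codimension as soon as a nonempty open piece of the solution set lies in the closure of
the Severi variety (`codimension_le_card`). For large `d` the coefficients of `x ^ d` and `x ^ (d -
1) * y` do not enter the equations. Making them algebraically independent over the remaining ones
forces the map to be injective and immersive away from the cusp: a failure would give `n + 1`
relations involving only three parameters, too many for the transcendence degree
(`relation_ne_zero`).

Genus. Every `fᵢ` has order at least `2m`. Below order `4m` only `1, f₁, …, fₙ` contribute values,
so `g ≥ 4m - n - 1`. Modulo `t ^ (2m + 2)` all `fᵢ` are proportional, so below order `6m + 2` the
cubics add one dimension to the polynomials of degree at most two, and `g ≥ 6m + 1 - (n + 2).choose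
2`. The second bound settles `n = 4, 5`, the first `n ≥ 6`.

Genericity. The number of values below `s` is lower semicontinuous in `f`, and the germs with a
given profile form an irreducible family. One germ with finitely many gaps bounds the conductor, so
finitely many open conditions determine the semigroup (`exists_isGenericValueSemigroup`).

Finally `n, m ≤ g`, so only finitely many profiles share a given `g`, and the degree threshold can
be made to depend on `g` alone. -/

namespace SeveriGen

/-! ### Orders of power series in finite-dimensional spaces, and value semigroups -/

open PowerSeries in
/-- A nonzero combination of power series with distinct orders has one of these orders. -/
theorem exists_order_sum_eq {ι : Type*} [Fintype ι] {h : ι → PowerSeries ℂ} {k : ι → ℕ}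
    (hk : Function.Injective k) (ho : ∀ i, order (h i) = (k i : ℕ∞)) {c : ι → ℂ} (hc : c ≠ 0) :
    ∃ i, c i ≠ 0 ∧ order (∑ i, c i • h i) = (k i : ℕ∞) := by
  classical
  obtain ⟨i₀, hi₀⟩ := Function.ne_iff.1 hc
  obtain ⟨i, hi, hmin⟩ := Finset.exists_min_image (Finset.univ.filter fun i => c i ≠ 0) k
    ⟨i₀, by simpa using hi₀⟩
  simp only [Finset.mem_filter, Finset.mem_univ, true_and] at hi hmin
  refine ⟨i, hi, (order_eq_nat).2 ⟨?_, fun j hj => ?_⟩⟩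
  · rw [map_sum, Finset.sum_eq_single i]
    · simpa using ⟨hi, ((order_eq_nat).1 (ho i)).1⟩
    · intro b _ hb
      by_cases hcb : c b = 0
      · simp [hcb]
      · have : k i < k b := lt_of_le_of_ne (hmin b hcb) fun e => hb (hk e.symm)
        simp [((order_eq_nat).1 (ho b)).2 _ this]
    · simp
  · rw [map_sum]
    refine Finset.sum_eq_zero fun b _ => ?_
    by_cases hcb : c b = 0
    · simp [hcb]
    · simp [((order_eq_nat).1 (ho b)).2 _ (hj.trans_le (hmin b hcb))]

theorem linearIndependent_of_order {ι : Type*} [Fintype ι] {h : ι → PowerSeries ℂ} {k : ι → ℕ}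
    (hk : Function.Injective k) (ho : ∀ i, PowerSeries.order (h i) = (k i : ℕ∞)) :
    LinearIndependent ℂ h := by
  rw [Fintype.linearIndependent_iff]
  intro c hc
  by_contra! hne
  obtain ⟨i, -, hi⟩ := exists_order_sum_eq hk ho (c := c) (fun e => by simp [e] at hne)
  simp [hc] at hi

/-- There are at most `r` orders of elements of a space spanned by `r` power series. -/
theorem card_le_of_order_mem_span {κ : Type*} [Fintype κ] (v : κ → PowerSeries ℂ) (T : Finset ℕ)
    (hT : ∀ s ∈ T, ∃ w ∈ Submodule.span ℂ (Set.range v), PowerSeries.order w = (s : ℕ∞)) :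
    T.card ≤ Fintype.card κ := by
  choose! w hw ho using hT
  have : FiniteDimensional ℂ (Submodule.span ℂ (Set.range v)) :=
    FiniteDimensional.span_of_finite ℂ (Set.finite_range v)
  have hli : LinearIndependent ℂ (fun s : T => (⟨w s, hw s s.2⟩ :
      Submodule.span ℂ (Set.range v))) := by
    refine LinearIndependent.of_comp (Submodule.subtype _) ?_
    exact linearIndependent_of_order (k := fun s : T => (s : ℕ)) Subtype.val_injective
      fun s => ho s s.2
  have := hli.fintype_card_le_finrank
  rw [Fintype.card_coe] at this
  exact this.trans (finrank_range_le_card v)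

theorem hasSubst {n : ℕ} {f : Fin n → PowerSeries ℂ}
    (hf : ∀ i, PowerSeries.constantCoeff (f i) = 0) : MvPowerSeries.HasSubst f :=
  MvPowerSeries.hasSubst_of_constantCoeff_zero hf

theorem subst_coe {n : ℕ} {f : Fin n → PowerSeries ℂ} (P : MvPolynomial (Fin n) ℂ) :
    (MvPowerSeries.subst f (P : MvPowerSeries (Fin n) ℂ) : PowerSeries ℂ) =
      MvPolynomial.aeval f P :=
  MvPowerSeries.subst_coe P

theorem coeff_prod_pow_eq_zero {n : ℕ} {f : Fin n → PowerSeries ℂ} {q : ℕ}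
    (hf : ∀ i, (q : ℕ∞) ≤ PowerSeries.order (f i)) (e : Fin n →₀ ℕ) {j : ℕ} (hj : j < q * e.degree) :
    PowerSeries.coeff j (e.prod fun i k => f i ^ k) = 0 := by
  apply PowerSeries.coeff_of_lt_order
  refine lt_of_lt_of_le (b := ((q * e.degree : ℕ) : ℕ∞)) (by exact_mod_cast hj) ?_
  rw [Finsupp.prod, PowerSeries.order_prod, Finsupp.degree_apply, Finset.mul_sum, Nat.cast_sum]
  refine Finset.sum_le_sum fun i _ => ?_
  rw [PowerSeries.order_pow, nsmul_eq_mul, mul_comm q, Nat.cast_mul]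
  gcongr
  exact hf i

theorem one_le_order {φ : PowerSeries ℂ} (h : PowerSeries.constantCoeff φ = 0) :
    ((1 : ℕ) : ℕ∞) ≤ PowerSeries.order φ := by
  refine PowerSeries.nat_le_order _ _ fun i hi => ?_
  obtain rfl : i = 0 := by omega
  simpa using h

/-- Up to any given order, a substitution in a power series is one in a polynomial. -/
theorem exists_polynomial_coeff_eq {n : ℕ} {f : Fin n → PowerSeries ℂ}
    (hf : ∀ i, PowerSeries.constantCoeff (f i) = 0) (G : MvPowerSeries (Fin n) ℂ) (N : ℕ) :
    ∃ P : MvPolynomial (Fin n) ℂ, ∀ j < N,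
      PowerSeries.coeff j (MvPowerSeries.subst f G : PowerSeries ℂ) =
        PowerSeries.coeff j (MvPolynomial.aeval f P) := by
  refine ⟨G.truncTotal N, fun j hj => ?_⟩
  rw [← subst_coe, PowerSeries.coeff, MvPowerSeries.coeff_subst (hasSubst hf),
    MvPowerSeries.coeff_subst (hasSubst hf)]
  refine finsum_congr fun e => ?_
  by_cases he : e.degree < N
  · rw [MvPolynomial.coeff_coe, MvPowerSeries.coeff_truncTotal _ he]
  · have := coeff_prod_pow_eq_zero (q := 1) (fun i => one_le_order (hf i)) e (j := j) (by omega)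
    rw [PowerSeries.coeff] at this
    rw [this, smul_zero, smul_zero]

/-- Whether a series has order `s` depends only on its coefficients up to `s`, so a truncation of
the power series `G` does as well as `G`. -/
theorem mem_valueSemigroup_iff {n : ℕ} {f : Fin n → PowerSeries ℂ}
    (hf : ∀ i, PowerSeries.constantCoeff (f i) = 0) {s : ℕ} :
    s ∈ valueSemigroup f ↔
      ∃ P : MvPolynomial (Fin n) ℂ, PowerSeries.order (MvPolynomial.aeval f P) = (s : ℕ∞) := by
  constructor
  · rintro ⟨G, hG⟩
    obtain ⟨P, hP⟩ := exists_polynomial_coeff_eq hf G (s + 1)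
    rw [PowerSeries.order_eq_nat] at hG
    refine ⟨P, PowerSeries.order_eq_nat.2 ⟨?_, fun i hi => ?_⟩⟩
    · rw [← hP _ (by omega)]; exact hG.1
    · rw [← hP _ (by omega)]; exact hG.2 i hi
  · rintro ⟨P, hP⟩
    exact ⟨P, by rwa [subst_coe]⟩

theorem add_mem_valueSemigroup {n : ℕ} {f : Fin n → PowerSeries ℂ}
    (hf : ∀ i, PowerSeries.constantCoeff (f i) = 0) {s t : ℕ}
    (hs : s ∈ valueSemigroup f) (ht : t ∈ valueSemigroup f) : s + t ∈ valueSemigroup f := by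
  rw [mem_valueSemigroup_iff hf] at *
  obtain ⟨P, hP⟩ := hs
  obtain ⟨Q, hQ⟩ := ht
  exact ⟨P * Q, by rw [map_mul, PowerSeries.order_mul, hP, hQ]; rfl⟩

theorem zero_mem_valueSemigroup {n : ℕ} {f : Fin n → PowerSeries ℂ}
    (hf : ∀ i, PowerSeries.constantCoeff (f i) = 0) : 0 ∈ valueSemigroup f := by
  rw [mem_valueSemigroup_iff hf]
  exact ⟨1, by simp⟩

theorem nsmul_mem_valueSemigroup {n : ℕ} {f : Fin n → PowerSeries ℂ}
    (hf : ∀ i, PowerSeries.constantCoeff (f i) = 0) {s : ℕ} (hs : s ∈ valueSemigroup f) (k : ℕ) :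
    k * s ∈ valueSemigroup f := by
  induction k with
  | zero => simpa using zero_mem_valueSemigroup hf
  | succ k ih => rw [add_mul, one_mul]; exact add_mem_valueSemigroup hf ih hs

theorem vanishingOrders_subset_valueSemigroup {n : ℕ} {f : Fin n → PowerSeries ℂ}
    (hf : ∀ i, PowerSeries.constantCoeff (f i) = 0) : vanishingOrders f ⊆ valueSemigroup f := by
  rintro s ⟨c₀, c, h⟩
  rw [mem_valueSemigroup_iff hf]
  refine ⟨MvPolynomial.C c₀ + ∑ i, c i • MvPolynomial.X i, ?_⟩
  rw [← h]
  congr 1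
  simp

/-- A bound for the number of small elements of the value semigroup. -/
theorem card_le_of_subset_valueSemigroup {n : ℕ} {f : Fin n → PowerSeries ℂ}
    (hf : ∀ i, PowerSeries.constantCoeff (f i) = 0) {κ : Type*} [Fintype κ]
    (v : κ → PowerSeries ℂ) (N : ℕ)
    (hv : ∀ P : MvPolynomial (Fin n) ℂ, ∃ w ∈ Submodule.span ℂ (Set.range v), ∀ j < N,
      PowerSeries.coeff j (MvPolynomial.aeval f P) = PowerSeries.coeff j w)
    (T : Finset ℕ) (hT : ∀ s ∈ T, s ∈ valueSemigroup f ∧ s < N) :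
    T.card ≤ Fintype.card κ := by
  refine card_le_of_order_mem_span v T fun s hs => ?_
  obtain ⟨h, hsN⟩ := hT s hs
  obtain ⟨P, hP⟩ := (mem_valueSemigroup_iff hf).1 h
  obtain ⟨w, hw, hPw⟩ := hv P
  rw [PowerSeries.order_eq_nat] at hP
  exact ⟨w, hw, PowerSeries.order_eq_nat.2 ⟨hPw s hsN ▸ hP.1,
    fun i hi => hPw i (hi.trans hsN) ▸ hP.2 i hi⟩⟩

/-- As many linearly independent jets, as many small elements of the value semigroup. -/
theorem le_ncard_of_det_ne_zero {n : ℕ} {f : Fin n → PowerSeries ℂ}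
    (hf : ∀ i, PowerSeries.constantCoeff (f i) = 0) {r N : ℕ} (P : Fin r → MvPolynomial (Fin n) ℂ)
    (s : Fin r → ℕ) (hs : ∀ i, s i < N)
    (hdet : (Matrix.of fun i j => PowerSeries.coeff (s i) (MvPolynomial.aeval f (P j))).det ≠ 0) :
    r ≤ Set.ncard (valueSemigroup f ∩ Set.Iio N) := by
  classical
  have hfin : (valueSemigroup f ∩ Set.Iio N).Finite := (Set.finite_Iio N).inter_of_right _
  rw [Set.ncard_eq_toFinset_card _ hfin]
  by_contra! hlt
  set T := hfin.toFinset with hTdef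
  -- With fewer than `r` values below `N`, some nonzero combination of the `P j` has zero
  -- coefficient at each of these values. By `hdet` it has a nonzero coefficient below `N`, so its
  -- order is one of these values: a contradiction.
  have : LinearMap.ker (Matrix.mulVecLin (Matrix.of fun (i : T) (j : Fin r) =>
      PowerSeries.coeff (i : ℕ) (MvPolynomial.aeval f (P j)))) ≠ ⊥ := by
    apply LinearMap.ker_ne_bot_of_finrank_lt
    simpa using hlt
  obtain ⟨c, hc, hc0⟩ := (Submodule.ne_bot_iff _).1 this
  have hcoeff : ∀ q, PowerSeries.coeff q (MvPolynomial.aeval f (∑ j, c j • P j)) =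
      ∑ j, PowerSeries.coeff q (MvPolynomial.aeval f (P j)) * c j := by
    intro q
    simp [map_sum, mul_comm]
  have hne : ∃ q < N, PowerSeries.coeff q (MvPolynomial.aeval f (∑ j, c j • P j)) ≠ 0 := by
    by_contra! hall
    refine hc0 (Matrix.eq_zero_of_mulVec_eq_zero hdet ?_)
    funext i
    have := hall (s i) (hs i)
    rw [hcoeff] at this
    simpa [Matrix.mulVec, dotProduct] using this
  obtain ⟨q, hqN, hq⟩ := hne
  obtain ⟨o, ho⟩ := ENat.ne_top_iff_exists.1
    (fun h => hq (by rw [PowerSeries.order_eq_top.1 h]; simp) :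
      PowerSeries.order (MvPolynomial.aeval f (∑ j, c j • P j)) ≠ ⊤)
  have hoq : o ≤ q := by
    have := PowerSeries.order_le q hq
    rw [← ho] at this
    exact_mod_cast this
  have hoT : o ∈ T := by
    rw [hTdef, Set.Finite.mem_toFinset]
    exact ⟨(mem_valueSemigroup_iff hf).2 ⟨_, ho.symm⟩, lt_of_le_of_lt hoq hqN⟩
  have h1 := (PowerSeries.order_eq_nat.1 ho.symm).1
  rw [hcoeff] at h1
  apply h1
  simpa [Matrix.mulVec, dotProduct] using congrFun (LinearMap.mem_ker.1 hc) ⟨o, hoT⟩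

/-! ### Ramification profiles and irreducibility of their parameter space -/

/-- The orders of the nonzero elements of a space of power series. -/
def spanOrders (W : Submodule ℂ (PowerSeries ℂ)) : Set ℕ :=
  {s | ∃ w ∈ W, PowerSeries.order w = (s : ℕ∞)}

theorem spanOrders_span_range {ι : Type*} [Fintype ι] {h : ι → PowerSeries ℂ} {k : ι → ℕ}
    (hk : Function.Injective k) (ho : ∀ i, PowerSeries.order (h i) = (k i : ℕ∞)) :
    spanOrders (Submodule.span ℂ (Set.range h)) = Set.range k := by
  ext s
  constructor
  · rintro ⟨w, hw, hs⟩
    obtain ⟨c, rfl⟩ := (Submodule.mem_span_range_iff_exists_fun ℂ).1 hw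
    have hc : c ≠ 0 := by
      rintro rfl
      simp at hs
    obtain ⟨i, -, hi⟩ := exists_order_sum_eq hk ho hc
    rw [hs] at hi
    exact ⟨i, by exact_mod_cast hi.symm⟩
  · rintro ⟨i, rfl⟩
    exact ⟨h i, Submodule.subset_span ⟨i, rfl⟩, ho i⟩

theorem vanishingOrders_eq {n : ℕ} (f : Fin n → PowerSeries ℂ) :
    vanishingOrders f = spanOrders (Submodule.span ℂ (insert 1 (Set.range f))) := by
  ext s
  have hC : ∀ c : ℂ, PowerSeries.C c = c • (1 : PowerSeries ℂ) := fun c => by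
    rw [PowerSeries.smul_eq_C_mul, mul_one]
  constructor
  · rintro ⟨c₀, c, h⟩
    refine ⟨_, Submodule.mem_span_insert.2 ⟨c₀, ∑ i, c i • f i, ?_, rfl⟩, by rw [← hC, h]⟩
    exact (Submodule.mem_span_range_iff_exists_fun ℂ).2 ⟨c, rfl⟩
  · rintro ⟨w, hw, h⟩
    obtain ⟨c₀, z, hz, rfl⟩ := Submodule.mem_span_insert.1 hw
    obtain ⟨c, rfl⟩ := (Submodule.mem_span_range_iff_exists_fun ℂ).1 hz
    exact ⟨c₀, c, by rw [hC, h]⟩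

theorem span_range_eq_of_det_ne_zero {ι : Type*} [Fintype ι] [DecidableEq ι]
    {f h : ι → PowerSeries ℂ} (g : Matrix ι ι ℂ) (hg : g.det ≠ 0)
    (hf : ∀ i, f i = ∑ j, g i j • h j) :
    Submodule.span ℂ (Set.range f) = Submodule.span ℂ (Set.range h) := by
  apply le_antisymm
  · rw [Submodule.span_le]
    rintro _ ⟨i, rfl⟩
    exact (Submodule.mem_span_range_iff_exists_fun ℂ).2 ⟨g i, (hf i).symm⟩
  · rw [Submodule.span_le]
    rintro _ ⟨i, rfl⟩
    refine (Submodule.mem_span_range_iff_exists_fun ℂ).2 ⟨g⁻¹ i, ?_⟩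
    simp only [hf, Finset.smul_sum, smul_smul]
    rw [Finset.sum_comm]
    simp only [← Finset.sum_smul]
    have : ∀ j, ∑ l, g⁻¹ i l * g l j = (1 : Matrix ι ι ℂ) i j := fun j => by
      rw [← Matrix.mul_apply, Matrix.nonsing_inv_mul _ (Ne.isUnit hg)]
    simp [this, Matrix.one_apply]

theorem span_insert_range_eq {n : ℕ} (h : Fin n → PowerSeries ℂ) :
    insert 1 (Set.range h) = Set.range (Fin.cons 1 h : Fin (n + 1) → PowerSeries ℂ) := by
  rw [Fin.range_cons]

theorem cons_injective {n : ℕ} {k : Fin n → ℕ} (hk : Function.Injective k) (hpos : ∀ i, 0 < k i) :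
    Function.Injective (Fin.cons 0 k : Fin (n + 1) → ℕ) := by
  rw [Fin.cons_injective_iff]
  exact ⟨by rintro ⟨i, hi⟩; exact (hpos i).ne' hi, hk⟩

/-- Choosing a combination of each order `k i` gives a matrix that is invertible because the orders
are distinct. The germs with profile `k` are thereby the image of pairs (invertible matrix, series
of orders `k i`), an open subset of a linear space; irreducibility rests on this. -/
theorem hasRamificationProfile_iff {n : ℕ} {f : Fin n → PowerSeries ℂ} {k : Fin n → ℕ}
    (hk : Function.Injective k) (hpos : ∀ i, 0 < k i) :
    HasRamificationProfile f k ↔ ∃ (g : Matrix (Fin n) (Fin n) ℂ) (h : Fin n → PowerSeries ℂ),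
      g.det ≠ 0 ∧ (∀ i, PowerSeries.order (h i) = (k i : ℕ∞)) ∧ ∀ i, f i = ∑ j, g i j • h j := by
  constructor
  · rintro ⟨hf, hv⟩
    have hex : ∀ i, ∃ c : Fin n → ℂ, PowerSeries.order (∑ j, c j • f j) = (k i : ℕ∞) := by
      intro i
      obtain ⟨c₀, c, hc⟩ : k i ∈ vanishingOrders f := by rw [hv]; exact Or.inr ⟨i, rfl⟩
      have h0 := (PowerSeries.order_eq_nat.1 hc).2 0 (hpos i)
      have : c₀ = 0 := by simpa [hf] using h0
      exact ⟨c, by simpa [this] using hc⟩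
    choose C hC using hex
    have hdet : (Matrix.of C).det ≠ 0 := by
      intro h0
      obtain ⟨v, hv0, hv⟩ := Matrix.exists_vecMul_eq_zero_iff.2 h0
      obtain ⟨i, -, hi⟩ := exists_order_sum_eq hk hC hv0
      have : ∑ i, v i • ∑ j, C i j • f j = ∑ j, (Matrix.vecMul v (Matrix.of C)) j • f j := by
        simp only [Finset.smul_sum, smul_smul]
        rw [Finset.sum_comm]
        simp only [← Finset.sum_smul]
        rfl
      rw [this, hv] at hi
      simp at hi
    refine ⟨(Matrix.of C)⁻¹, fun i => ∑ j, C i j • f j, ?_, hC, fun i => ?_⟩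
    · exact (Matrix.isUnit_nonsing_inv_det _ (Ne.isUnit hdet)).ne_zero
    · simp only [Finset.smul_sum, smul_smul]
      rw [Finset.sum_comm]
      simp only [← Finset.sum_smul]
      have : ∀ j, ∑ l, (Matrix.of C)⁻¹ i l * C l j = (1 : Matrix (Fin n) (Fin n) ℂ) i j :=
        fun j => by
          rw [← Matrix.nonsing_inv_mul _ (Ne.isUnit hdet), Matrix.mul_apply]
          rfl
      simp [this, Matrix.one_apply]
  · rintro ⟨g, h, hg, ho, hf⟩
    refine ⟨fun i => ?_, ?_⟩
    · rw [hf, map_sum]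
      refine Finset.sum_eq_zero fun j _ => ?_
      have := (PowerSeries.order_eq_nat.1 (ho j)).2 0 (hpos j)
      simp only [PowerSeries.coeff_zero_eq_constantCoeff] at this
      rw [PowerSeries.constantCoeff_smul, this, smul_zero]
    · rw [vanishingOrders_eq, Submodule.span_insert, span_range_eq_of_det_ne_zero g hg hf,
        ← Submodule.span_insert, span_insert_range_eq, spanOrders_span_range (k := Fin.cons 0 k)
          (cons_injective hk hpos), Fin.range_cons]
      intro i
      refine Fin.cases ?_ (fun i => ?_) i
      · simp
      · simpa using ho i

theorem HasRamificationProfile.le_order {n : ℕ} {f : Fin n → PowerSeries ℂ} {k : Fin n → ℕ}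
    (hf : HasRamificationProfile f k) {q : ℕ} (hq : ∀ i, q ≤ k i) (i : Fin n) :
    (q : ℕ∞) ≤ PowerSeries.order (f i) := by
  by_cases htop : PowerSeries.order (f i) = ⊤
  · simp [htop]
  obtain ⟨s, hs⟩ := ENat.ne_top_iff_exists.1 htop
  have hmem : s ∈ vanishingOrders f := ⟨0, Pi.single i 1, by simp [Pi.single_apply, hs]⟩
  rw [← hs]
  rw [hf.2] at hmem
  rcases hmem with rfl | ⟨j, rfl⟩
  · exact absurd (hf.1 i) (by simpa using (PowerSeries.order_eq_nat.1 hs.symm).1)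
  · exact_mod_cast hq j

/-- The space of germs with a given ramification profile is irreducible. -/
theorem exists_evalCoeffs_mul_ne_zero {n : ℕ} {k : Fin n → ℕ}
    (hk : Function.Injective k) (hpos : ∀ i, 0 < k i) {Q₁ Q₂ : MvPolynomial (Fin n × ℕ) ℂ}
    {f₁ f₂ : Fin n → PowerSeries ℂ} (hf₁ : HasRamificationProfile f₁ k)
    (hf₂ : HasRamificationProfile f₂ k) (h₁ : evalCoeffs Q₁ f₁ ≠ 0) (h₂ : evalCoeffs Q₂ f₂ ≠ 0) :
    ∃ f, HasRamificationProfile f k ∧ evalCoeffs (Q₁ * Q₂) f ≠ 0 := by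
  open Polynomial in
  obtain ⟨g₁, a₁, hg₁, ho₁, e₁⟩ := (hasRamificationProfile_iff hk hpos).1 hf₁
  obtain ⟨g₂, a₂, hg₂, ho₂, e₂⟩ := (hasRamificationProfile_iff hk hpos).1 hf₂
  -- Both the matrix and the series are interpolated linearly; all coefficients of the resulting
  -- germ are polynomials in the parameter.
  let G : Matrix (Fin n) (Fin n) ℂ[X] :=
    Matrix.of fun i j => (1 - X) * C (g₁ i j) + X * C (g₂ i j)
  let A : Fin n → ℕ → ℂ[X] := fun j l =>
    (1 - X) * C (PowerSeries.coeff l (a₁ j)) + X * C (PowerSeries.coeff l (a₂ j))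
  let F : Fin n × ℕ → ℂ[X] := fun il => ∑ j, G il.1 j * A j il.2
  let f : ℂ → Fin n → PowerSeries ℂ := fun z i =>
    ∑ j, (G i j).eval z • PowerSeries.mk fun l => (A j l).eval z
  have hfc : ∀ z i l, PowerSeries.coeff l (f z i) = (F (i, l)).eval z := by
    intro z i l
    simp only [f, F, map_sum, eval_finsetSum, eval_mul, PowerSeries.coeff_smul,
      PowerSeries.coeff_mk, smul_eq_mul]
  have hev : ∀ z Q, evalCoeffs Q (f z) = (MvPolynomial.aeval F Q).eval z := by
    intro z Q
    rw [evalCoeffs, MvPolynomial.aeval_def, ← Polynomial.coe_evalRingHom,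
      MvPolynomial.hom_eval₂, ← MvPolynomial.coe_eval₂Hom, MvPolynomial.eval]
    congr 2
    · ext x
      simp
    · funext il
      exact hfc z il.1 il.2
  have hf0 : f 0 = f₁ := by
    funext i
    ext l
    rw [hfc, e₁]
    simp [F, G, A, eval_finsetSum]
  have hf1 : f 1 = f₂ := by
    funext i
    ext l
    rw [hfc, e₂]
    simp [F, G, A, eval_finsetSum]
  -- The determinant and the leading coefficients are included so that the germ at the chosen
  -- parameter still has profile `k`.
  have hprod : G.det * (∏ j, A j (k j)) * (MvPolynomial.aeval F Q₁ * MvPolynomial.aeval F Q₂) ≠ 0 := by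
    refine mul_ne_zero (mul_ne_zero ?_ ?_) (mul_ne_zero ?_ ?_)
    · intro h
      have h0 : (G.det).eval 0 = 0 := by rw [h, eval_zero]
      rw [← Polynomial.coe_evalRingHom, RingHom.map_det] at h0
      refine hg₁ (Eq.trans ?_ h0)
      congr 1
      ext i j
      simp [G]
    · refine Finset.prod_ne_zero_iff.2 fun j _ h => ?_
      have h0 : (A j (k j)).eval 0 = 0 := by rw [h, eval_zero]
      exact (PowerSeries.order_eq_nat.1 (ho₁ j)).1 (by simpa [A] using h0)
    · intro h
      apply h₁
      rw [← hf0, hev, h, eval_zero]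
    · intro h
      apply h₂
      rw [← hf1, hev, h, eval_zero]
  obtain ⟨z, hz⟩ : ∃ z, (G.det * (∏ j, A j (k j)) *
      (MvPolynomial.aeval F Q₁ * MvPolynomial.aeval F Q₂)).eval z ≠ 0 := by
    by_contra! hall
    exact hprod (Polynomial.funext fun z => by rw [hall z, eval_zero])
  simp only [eval_mul, eval_prod, mul_ne_zero_iff, Finset.prod_ne_zero_iff] at hz
  refine ⟨f z, (hasRamificationProfile_iff hk hpos).2
    ⟨G.map (eval z), fun j => PowerSeries.mk fun l => (A j l).eval z, ?_, fun j => ?_,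
      fun i => rfl⟩, ?_⟩
  · have h := hz.1.1
    rwa [← Polynomial.coe_evalRingHom, RingHom.map_det] at h
  · refine PowerSeries.order_eq_nat.2 ⟨?_, fun l hl => ?_⟩
    · rw [PowerSeries.coeff_mk]
      exact hz.1.2 j (Finset.mem_univ _)
    · simp [A, (PowerSeries.order_eq_nat.1 (ho₁ j)).2 l hl, (PowerSeries.order_eq_nat.1 (ho₂ j)).2 l hl]
  · rw [hev, map_mul, eval_mul]
    exact mul_ne_zero hz.2.1 hz.2.2

theorem exists_evalCoeffs_prod_ne_zero {n : ℕ} {k : Fin n → ℕ}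
    (hk : Function.Injective k) (hpos : ∀ i, 0 < k i) {ι : Type*} (I : Finset ι)
    (Q : ι → MvPolynomial (Fin n × ℕ) ℂ) (f₀ : Fin n → PowerSeries ℂ)
    (hf₀ : HasRamificationProfile f₀ k)
    (hQ : ∀ i ∈ I, ∃ f, HasRamificationProfile f k ∧ evalCoeffs (Q i) f ≠ 0) :
    ∃ f, HasRamificationProfile f k ∧ evalCoeffs (∏ i ∈ I, Q i) f ≠ 0 := by
  classical
  induction I using Finset.induction_on with
  | empty => exact ⟨f₀, hf₀, by simp [evalCoeffs]⟩
  | insert i I hi ih =>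
    obtain ⟨f₁, hf₁, h₁⟩ := hQ i (Finset.mem_insert_self _ _)
    obtain ⟨f₂, hf₂, h₂⟩ := ih fun j hj => hQ j (Finset.mem_insert_of_mem hj)
    rw [Finset.prod_insert hi]
    exact exists_evalCoeffs_mul_ne_zero hk hpos hf₁ hf₂ h₁ h₂

/-! ### Existence and uniqueness of the generic value semigroup -/

/-- A set of naturals closed under addition with at most `δ` gaps in a long initial interval has
no gap `≥ 2 * δ`. -/
theorem mem_of_two_mul_le {S : Set ℕ} (hadd : ∀ a ∈ S, ∀ b ∈ S, a + b ∈ S) {δ N : ℕ}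
    (hN : 4 * δ + 4 ≤ N) (hcard : N ≤ (S ∩ Set.Iio N).ncard + δ) {x : ℕ} (hx : 2 * δ ≤ x) :
    x ∈ S := by
  classical
  set T := (Finset.range N).filter (· ∉ S) with hT
  have hTcard : T.card ≤ δ := by
    have h1 : (S ∩ Set.Iio N).ncard = ((Finset.range N).filter (· ∈ S)).card := by
      rw [← Set.ncard_coe_finset]
      congr 1
      ext y
      simp [and_comm]
    have h2 : ((Finset.range N).filter (· ∈ S)).card + T.card = (Finset.range N).card :=
      Finset.card_filter_add_card_filter_not _
    rw [Finset.card_range] at h2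
    omega
  induction x using Nat.strong_induction_on with
  | _ x ih =>
  by_contra hxS
  rcases lt_or_ge x N with hxN | hxN
  -- For a gap `x`, one of `i` and `x - i` is a gap. Since `i ≤ δ ≤ x - i`, the choices for `i = 0,
  -- …, δ` are distinct: `δ + 1` gaps below `N`.
  · have : (Finset.range (δ + 1)).card ≤ T.card := by
      refine Finset.card_le_card_of_injOn (fun i => if i ∈ S then x - i else i) ?_ ?_
      · intro i hi
        have hi' : i < δ + 1 := by simpa using hi
        simp only [hT, Finset.coe_filter, Finset.mem_range, Set.mem_ofPred_eq]
        split_ifs with his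
        · refine ⟨by omega, fun h => hxS ?_⟩
          have := hadd _ his _ h
          rwa [Nat.add_sub_cancel' (by omega)] at this
        · exact ⟨by omega, his⟩
      · intro i hi j hj hij
        have hi' : i < δ + 1 := by simpa using hi
        have hj' : j < δ + 1 := by simpa using hj
        dsimp only at hij
        split_ifs at hij <;> omega
    rw [Finset.card_range] at this
    omega
  -- By induction `x - i` lies in `S` for `1 ≤ i ≤ δ + 1`, so each such `i` would be a gap.
  · have : (Finset.Icc 1 (δ + 1)).card ≤ T.card := by
      refine Finset.card_le_card fun i hi => ?_
      rw [Finset.mem_Icc] at hi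
      simp only [hT, Finset.mem_filter, Finset.mem_range]
      refine ⟨by omega, fun his => hxS ?_⟩
      have := hadd _ his _ (ih (x - i) (by omega) (by omega))
      rwa [Nat.add_sub_cancel' (by omega)] at this
    rw [Nat.card_Icc] at this
    omega

/-- The coefficient of `t ^ l` in `P(f)`, as a polynomial in the coefficients of `f`. -/
noncomputable def coeffPoly {n : ℕ} (P : MvPolynomial (Fin n) ℂ) (l : ℕ) :
    MvPolynomial (Fin n × ℕ) ℂ :=
  PowerSeries.coeff l (MvPolynomial.eval₂ (PowerSeries.C.comp MvPolynomial.C)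
    (fun i => PowerSeries.mk fun j => MvPolynomial.X (i, j)) P)

theorem evalCoeffs_coeffPoly {n : ℕ} (P : MvPolynomial (Fin n) ℂ) (l : ℕ)
    (f : Fin n → PowerSeries ℂ) :
    evalCoeffs (coeffPoly P l) f = PowerSeries.coeff l (MvPolynomial.aeval f P) := by
  rw [evalCoeffs, coeffPoly, ← PowerSeries.coeff_map, MvPolynomial.hom_eval₂,
    MvPolynomial.aeval_def]
  congr 2
  · ext c
    simp
  · funext i
    ext j
    simp

/-- Lower semicontinuity of the number of small elements of the value semigroup. -/
theorem exists_ncard_le {n : ℕ} {f₀ : Fin n → PowerSeries ℂ}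
    (hf₀ : ∀ i, PowerSeries.constantCoeff (f₀ i) = 0) (N : ℕ) :
    ∃ Q : MvPolynomial (Fin n × ℕ) ℂ, evalCoeffs Q f₀ ≠ 0 ∧
      ∀ f : Fin n → PowerSeries ℂ, (∀ i, PowerSeries.constantCoeff (f i) = 0) →
        evalCoeffs Q f ≠ 0 →
        (valueSemigroup f₀ ∩ Set.Iio N).ncard ≤ (valueSemigroup f ∩ Set.Iio N).ncard := by
  classical
  have hfin : (valueSemigroup f₀ ∩ Set.Iio N).Finite := (Set.finite_Iio N).inter_of_right _
  set r := (valueSemigroup f₀ ∩ Set.Iio N).ncard with hr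
  have hcard : hfin.toFinset.card = r := by rw [hr, Set.ncard_eq_toFinset_card _ hfin]
  let s := hfin.toFinset.orderEmbOfFin hcard
  have hs : ∀ i, s i ∈ valueSemigroup f₀ ∧ s i < N := fun i =>
    hfin.mem_toFinset.1 (hfin.toFinset.orderEmbOfFin_mem hcard i)
  choose P hP using fun i => (mem_valueSemigroup_iff hf₀).1 (hs i).1
  have hdet : ∀ f, evalCoeffs (Matrix.of fun i j => coeffPoly (P j) (s i)).det f =
      (Matrix.of fun i j => PowerSeries.coeff (s i) (MvPolynomial.aeval f (P j))).det := by
    intro f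
    rw [evalCoeffs, RingHom.map_det]
    congr 1
    ext i j
    exact evalCoeffs_coeffPoly _ _ _
  refine ⟨(Matrix.of fun i j => coeffPoly (P j) (s i)).det, ?_, fun f hf h => ?_⟩
  -- At `f₀` the `j`-th column is a series of order `s j`: the matrix is triangular with leading
  -- coefficients on the diagonal.
  · rw [hdet, Matrix.det_of_isLowerTriangular]
    · exact Finset.prod_ne_zero_iff.2 fun i _ => (PowerSeries.order_eq_nat.1 (hP i)).1
    · intro i j hij
      exact (PowerSeries.order_eq_nat.1 (hP j)).2 _ (s.strictMono hij)
  · rw [hdet] at h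
    exact le_ncard_of_det_ne_zero hf P s (fun i => (hs i).2) h

/-- It recovers a set from its counting function, the quantity that semicontinuity controls. -/
theorem mem_iff_ncard_inter_Iio_ne (S : Set ℕ) (x : ℕ) :
    x ∈ S ↔ (S ∩ Set.Iio x).ncard ≠ (S ∩ Set.Iio (x + 1)).ncard := by
  have hfin : (S ∩ Set.Iio x).Finite := (Set.finite_Iio x).inter_of_right _
  constructor
  · intro h
    have : S ∩ Set.Iio (x + 1) = insert x (S ∩ Set.Iio x) := by
      ext y
      simp only [Set.mem_inter_iff, Set.mem_Iio, Set.mem_insert_iff]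
      constructor
      · rintro ⟨hy, hlt⟩
        rcases Nat.lt_succ_iff_lt_or_eq.1 hlt with h | h
        · exact Or.inr ⟨hy, h⟩
        · exact Or.inl h
      · rintro (rfl | ⟨hy, hlt⟩)
        · exact ⟨h, by omega⟩
        · exact ⟨hy, by omega⟩
    rw [this, Set.ncard_insert_of_notMem (by simp) hfin]
    omega
  · intro h
    by_contra hx
    apply h
    congr 1
    ext y
    simp only [Set.mem_inter_iff, Set.mem_Iio]
    refine and_congr_right fun hy => ⟨fun h => by omega, fun h => ?_⟩
    have : y ≠ x := by rintro rfl; exact hx hy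
    omega

/-- If some germ with the given ramification profile has a value semigroup with finite complement,
then there is exactly one value semigroup of a generic germ with this profile. -/
theorem exists_isGenericValueSemigroup {n : ℕ} {k : Fin n → ℕ}
    (hk : Function.Injective k) (hpos : ∀ i, 0 < k i) {f₀ : Fin n → PowerSeries ℂ}
    (hf₀ : HasRamificationProfile f₀ k) (hfin : (valueSemigroup f₀)ᶜ.Finite) :
    ∃ S : Set ℕ, (∀ S', IsGenericValueSemigroup k S' ↔ S' = S) ∧ Sᶜ.Finite ∧
      ∃ f, HasRamificationProfile f k ∧ valueSemigroup f = S := by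
  classical
  set δ := (valueSemigroup f₀)ᶜ.ncard with hδ
  set N := 4 * δ + 4 with hN
  have hIio : ∀ s : ℕ, (Set.Iio s).ncard = s := fun s => by
    rw [← Finset.coe_Iio, Set.ncard_coe_finset, Nat.card_Iio]
  have hle : ∀ (S : Set ℕ) (s : ℕ), (S ∩ Set.Iio s).ncard ≤ s := fun S s => by
    exact (Set.ncard_le_ncard Set.inter_subset_right (Set.finite_Iio s)).trans (hIio s).le
  -- For each `s` separately, a germ with the most values below `s`; irreducibility then provides
  -- one germ attaining all these maxima for `s ≤ N`.
  have hmax : ∀ s, ∃ f, HasRamificationProfile f k ∧ ∀ f', HasRamificationProfile f' k →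
      (valueSemigroup f' ∩ Set.Iio s).ncard ≤ (valueSemigroup f ∩ Set.Iio s).ncard := by
    intro s
    let A : Set ℕ := {r | ∃ f, HasRamificationProfile f k ∧
      (valueSemigroup f ∩ Set.Iio s).ncard = r}
    have hbdd : BddAbove A := ⟨s, by rintro _ ⟨f, -, rfl⟩; exact hle _ _⟩
    obtain ⟨f, hf, h⟩ := Nat.sSup_mem (s := A) ⟨_, f₀, hf₀, rfl⟩ hbdd
    exact ⟨f, hf, fun f' hf' => h ▸ le_csSup hbdd ⟨f', hf', rfl⟩⟩
  choose F hF hFmax using hmax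
  choose Q hQ hQle using fun s => exists_ncard_le (hF s).1 s
  obtain ⟨f, hf, hfQ⟩ := exists_evalCoeffs_prod_ne_zero hk hpos (Finset.range (N + 1)) Q f₀ hf₀
    fun s _ => ⟨F s, hF s, hQ s⟩
  have key : ∀ f, HasRamificationProfile f k →
      evalCoeffs (∏ s ∈ Finset.range (N + 1), Q s) f ≠ 0 →
      (∀ s ≤ N, (valueSemigroup f ∩ Set.Iio s).ncard = (valueSemigroup (F s) ∩ Set.Iio s).ncard) ∧
        ∀ x, 2 * δ ≤ x → x ∈ valueSemigroup f := by
    intro f hf hfQ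
    have h : ∀ s ≤ N,
        (valueSemigroup f ∩ Set.Iio s).ncard = (valueSemigroup (F s) ∩ Set.Iio s).ncard := by
      intro s hs
      refine le_antisymm (hFmax s f hf) (hQle s f hf.1 ?_)
      rw [evalCoeffs, map_prod, Finset.prod_ne_zero_iff] at hfQ
      exact hfQ s (Finset.mem_range.2 (by omega))
    refine ⟨h, fun x hx => mem_of_two_mul_le (N := N)
      (fun a ha b hb => add_mem_valueSemigroup hf.1 ha hb) hN.ge ?_ hx⟩
    have h1 : (valueSemigroup f₀ ∩ Set.Iio N).ncard ≤ (valueSemigroup f ∩ Set.Iio N).ncard := by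
      rw [h N le_rfl]
      exact hFmax N f₀ hf₀
    have h2 : (Set.Iio N : Set ℕ).ncard ≤
        (valueSemigroup f₀ ∩ Set.Iio N).ncard + (valueSemigroup f₀)ᶜ.ncard := by
      refine le_trans (Set.ncard_le_ncard ?_ (((Set.finite_Iio N).inter_of_right _).union hfin))
        (Set.ncard_union_le _ _)
      intro y hy
      by_cases hyS : y ∈ valueSemigroup f₀
      · exact Or.inl ⟨hyS, hy⟩
      · exact Or.inr hyS
    rw [hIio, ← hδ] at h2
    omega
  have hgen : IsGenericValueSemigroup k (valueSemigroup f) := by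
    refine ⟨_, ⟨f, hf, hfQ⟩, fun f' hf' hfQ' => ?_⟩
    obtain ⟨h1, h2⟩ := key f hf hfQ
    obtain ⟨h1', h2'⟩ := key f' hf' hfQ'
    ext x
    rcases lt_or_ge x N with hx | hx
    · rw [mem_iff_ncard_inter_Iio_ne, mem_iff_ncard_inter_Iio_ne (valueSemigroup f), h1 x hx.le, h1' x hx.le,
        h1 (x + 1) hx, h1' (x + 1) hx]
    · exact ⟨fun _ => h2 x (by omega), fun _ => h2' x (by omega)⟩
  refine ⟨valueSemigroup f, fun S' => ⟨?_, fun h => h ▸ hgen⟩, ?_, f, hf, rfl⟩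
  -- Uniqueness: two nonempty open sets of germs meet.
  · rintro ⟨Q', ⟨f', hf', hQ'⟩, hS'⟩
    obtain ⟨Q₁, ⟨f₁, hf₁, hQ₁⟩, hS⟩ := hgen
    obtain ⟨φ, hφ, h⟩ := exists_evalCoeffs_mul_ne_zero hk hpos hf' hf₁ hQ' hQ₁
    rw [evalCoeffs, map_mul, mul_ne_zero_iff] at h
    rw [← hS' φ hφ h.1, ← hS φ hφ h.2]
  · refine (Set.finite_Iio (2 * δ)).subset fun x hx => ?_
    by_contra h
    exact hx ((key f hf hfQ).2 x (by simpa using h))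

/-! ### Even profiles: finiteness of the gaps, lower bounds for the genus, and the numerical
comparison -/

theorem evenProfile_injective (n m : ℕ) : Function.Injective (evenProfile n m) := by
  intro i j h
  simp only [evenProfile] at h
  exact Fin.ext (by omega)

theorem evenProfile_pos {n m : ℕ} (hm : 0 < m) (i : Fin n) : 0 < evenProfile n m i := by
  simp only [evenProfile]
  omega

theorem hasRamificationProfile_of_order {n : ℕ} {f : Fin n → PowerSeries ℂ} {k : Fin n → ℕ}
    (hk : Function.Injective k) (hpos : ∀ i, 0 < k i)
    (ho : ∀ i, PowerSeries.order (f i) = (k i : ℕ∞)) : HasRamificationProfile f k :=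
  (hasRamificationProfile_iff hk hpos).2 ⟨1, f, by simp, ho, fun i => by simp [Matrix.one_apply]⟩

/-- Pure even monomials would give only even values. A factor `1 + t` in the second coordinate alone
produces an odd value, which together with the consecutive even values `2m`, `2m + 2` makes the gcd
equal to `1`. -/
theorem exists_evenProfile_finite_compl {n m : ℕ} (hn : 3 ≤ n) (hm : 0 < m) :
    ∃ f, HasRamificationProfile f (evenProfile n m) ∧ (valueSemigroup f)ᶜ.Finite := by
  let f : Fin n → PowerSeries ℂ := fun i =>
    PowerSeries.X ^ (2 * m + 2 * (i : ℕ)) * (1 + if (i : ℕ) = 1 then PowerSeries.X else 0)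
  have ho : ∀ i, PowerSeries.order (f i) = (evenProfile n m i : ℕ∞) := by
    intro i
    rw [PowerSeries.order_mul, PowerSeries.order_X_pow, PowerSeries.order_eq_nat (n := 0) |>.2]
    · simp [evenProfile]
    · refine ⟨?_, by simp⟩
      split_ifs <;> simp
  have hprof : HasRamificationProfile f (evenProfile n m) :=
    hasRamificationProfile_of_order (evenProfile_injective n m) (evenProfile_pos hm) ho
  refine ⟨f, hprof, ?_⟩
  have hmem : ∀ i : Fin n, 2 * m + 2 * (i : ℕ) ∈ valueSemigroup f := fun i =>
    vanishingOrders_subset_valueSemigroup hprof.1 (by rw [hprof.2]; exact Or.inr ⟨i, rfl⟩)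
  have hodd : 4 * m + 5 ∈ valueSemigroup f := by
    rw [mem_valueSemigroup_iff hprof.1]
    -- `f₀ f₂ - f₁² = t ^ (4m + 4) (1 - (1 + t)²)`, whose order is `4m + 5`.
    refine ⟨MvPolynomial.X ⟨0, by omega⟩ * MvPolynomial.X ⟨2, by omega⟩ -
      MvPolynomial.X ⟨1, by omega⟩ ^ 2, ?_⟩
    have : MvPolynomial.aeval f (MvPolynomial.X ⟨0, by omega⟩ * MvPolynomial.X ⟨2, by omega⟩ -
      MvPolynomial.X ⟨1, by omega⟩ ^ 2 : MvPolynomial (Fin n) ℂ) =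
        PowerSeries.X ^ (4 * m + 5) * (PowerSeries.C (-2) - PowerSeries.X) := by
      simp only [map_sub, map_mul, map_pow, MvPolynomial.aeval_X, f]
      simp only [map_neg, map_ofNat]
      norm_num
      ring
    rw [this, PowerSeries.order_mul, PowerSeries.order_X_pow, PowerSeries.order_eq_nat (n := 0) |>.2]
    · simp
    · simp
  let M : AddSubmonoid ℕ :=
    { carrier := valueSemigroup f
      zero_mem' := zero_mem_valueSemigroup hprof.1
      add_mem' := fun ha hb => add_mem_valueSemigroup hprof.1 ha hb }
  obtain ⟨N, hN⟩ := Nat.exists_mem_closure_of_ge (M : Set ℕ)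
  have hgcd : Nat.setGcd (M : Set ℕ) = 1 := by
    have h0 := Nat.setGcd_dvd_of_mem (s := (M : Set ℕ)) (hmem ⟨0, by omega⟩)
    have h1 := Nat.setGcd_dvd_of_mem (s := (M : Set ℕ)) (hmem ⟨1, by omega⟩)
    have h2 := Nat.setGcd_dvd_of_mem (s := (M : Set ℕ)) hodd
    simp only [mul_zero, add_zero, mul_one] at h0 h1
    have h3 : Nat.setGcd (M : Set ℕ) ∣ 2 := (Nat.dvd_add_right h0).1 h1
    have h4 : Nat.setGcd (M : Set ℕ) ∣ 1 := by
      have : Nat.setGcd (M : Set ℕ) ∣ 2 * (2 * m + 2) + 1 := by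
        convert h2 using 1
        ring
      exact (Nat.dvd_add_right (h3.mul_right _)).1 this
    exact Nat.dvd_one.1 h4
  refine (Set.finite_Iio N).subset fun x hx => ?_
  by_contra h
  have := hN x (by simpa using h) (by rw [hgcd]; exact one_dvd _)
  rw [AddSubmonoid.closure_eq] at this
  exact hx this

open PowerSeries in
-- If modulo `t ^ N` all monomials in `f` lie in the span of `v`, then at most `#κ` numbers below
-- `N` are values, and the others are gaps.
theorem le_ncard_compl_add {n : ℕ} {f : Fin n → PowerSeries ℂ}
    (hf : ∀ i, constantCoeff (f i) = 0) (hfin : (valueSemigroup f)ᶜ.Finite)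
    {κ : Type*} [Fintype κ] (v : κ → PowerSeries ℂ) (N : ℕ)
    (hv : ∀ e : Fin n →₀ ℕ, ∃ w ∈ Submodule.span ℂ (Set.range v),
      X ^ N ∣ (e.prod fun i k => f i ^ k) - w) :
    N ≤ (valueSemigroup f)ᶜ.ncard + Fintype.card κ := by
  classical
  choose w hw hdvd using hv
  have h1 := card_le_of_subset_valueSemigroup hf v N (fun P =>
    ⟨∑ e ∈ P.support, P.coeff e • w e,
      Submodule.sum_mem _ fun e _ => Submodule.smul_mem _ _ (hw e), ?_⟩)
    ((Finset.range N).filter (· ∈ valueSemigroup f)) (fun s hs => by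
      rw [Finset.mem_filter, Finset.mem_range] at hs
      exact ⟨hs.2, hs.1⟩)
  · have h2 := Finset.card_filter_add_card_filter_not (s := Finset.range N)
      (fun y => y ∈ valueSemigroup f)
    rw [Finset.card_range] at h2
    have h3 : ((Finset.range N).filter fun y => y ∉ valueSemigroup f).card ≤
        (valueSemigroup f)ᶜ.ncard := by
      rw [← Set.ncard_coe_finset]
      refine Set.ncard_le_ncard (fun y hy => ?_) hfin
      simpa using (Finset.mem_filter.1 hy).2
    omega
  · intro j hj
    rw [← sub_eq_zero, ← map_sub]
    have : MvPolynomial.aeval f P - ∑ e ∈ P.support, P.coeff e • w e =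
        ∑ e ∈ P.support, P.coeff e • ((e.prod fun i k => f i ^ k) - w e) := by
      have hP : MvPolynomial.aeval f P =
          ∑ e ∈ P.support, P.coeff e • (e.prod fun i k => f i ^ k) := by
        rw [MvPolynomial.aeval_def, MvPolynomial.eval₂_eq']
        refine Finset.sum_congr rfl fun e _ => ?_
        rw [Algebra.smul_def, Finsupp.prod_fintype _ _ (by simp)]
      rw [hP, ← Finset.sum_sub_distrib]
      simp only [smul_sub]
    rw [this, map_sum]
    refine Finset.sum_eq_zero fun e _ => ?_
    rw [PowerSeries.coeff_smul, X_pow_dvd_iff.1 (hdvd e) j hj, smul_zero]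

theorem exists_prod_pow_eq_mul {n : ℕ} (f : Fin n → PowerSeries ℂ) {e : Fin n →₀ ℕ} {q : ℕ}
    (he : e.degree = q + 1) : ∃ (i : Fin n) (e' : Fin n →₀ ℕ), e'.degree = q ∧
      (e.prod fun i k => f i ^ k) = f i * e'.prod fun i k => f i ^ k := by
  classical
  obtain ⟨i, hi⟩ : ∃ i, e i ≠ 0 := by
    by_contra! h
    have : e = 0 := Finsupp.ext h
    simp [this] at he
  have hle : Finsupp.single i 1 ≤ e := by
    rw [Finsupp.single_le_iff]
    omega
  have hadd : Finsupp.single i 1 + (e - Finsupp.single i 1) = e := add_tsub_cancel_of_le hle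
  refine ⟨i, e - Finsupp.single i 1, ?_, ?_⟩
  · have := congrArg Finsupp.degree hadd
    rw [map_add, he, Finsupp.degree_single] at this
    omega
  · conv_lhs => rw [← hadd]
    rw [Finsupp.prod_add_index' (by simp) (by intros; rw [pow_add]),
      Finsupp.prod_single_index (by simp), pow_one]

theorem X_pow_dvd_prod_pow {n : ℕ} {f : Fin n → PowerSeries ℂ} {q N : ℕ}
    (hf : ∀ i, (q : ℕ∞) ≤ PowerSeries.order (f i)) (e : Fin n →₀ ℕ) (hN : N ≤ q * e.degree) :
    PowerSeries.X ^ N ∣ e.prod fun i k => f i ^ k :=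
  PowerSeries.X_pow_dvd_iff.2 fun _ hj => coeff_prod_pow_eq_zero hf e (hj.trans_le hN)

/-- The bound for the number of gaps given by the linear forms. -/
theorem evenProfile_linear_gaps {n m : ℕ} {f : Fin n → PowerSeries ℂ}
    (hf : HasRamificationProfile f (evenProfile n m)) (hfin : (valueSemigroup f)ᶜ.Finite) :
    4 * m ≤ (valueSemigroup f)ᶜ.ncard + (n + 1) := by
  have hq : ∀ i, ((2 * m : ℕ) : ℕ∞) ≤ PowerSeries.order (f i) :=
    hf.le_order fun i => by simp [evenProfile]
  have := le_ncard_compl_add hf.1 hfin (Fin.cons 1 f : Fin (n + 1) → PowerSeries ℂ) (4 * m) ?_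
  · simpa using this
  intro e
  match he : e.degree with
  | 0 =>
    refine ⟨1, Submodule.subset_span ⟨0, rfl⟩, ?_⟩
    rw [(Finsupp.degree_eq_zero_iff e).1 he]
    simp
  | 1 =>
    obtain ⟨i, e', he', h⟩ := exists_prod_pow_eq_mul f he
    refine ⟨f i, Submodule.subset_span ⟨i.succ, rfl⟩, ?_⟩
    rw [h, (Finsupp.degree_eq_zero_iff e').1 he']
    simp
  | q + 2 =>
    refine ⟨0, zero_mem _, ?_⟩
    rw [sub_zero]
    exact X_pow_dvd_prod_pow hq e (by rw [he]; nlinarith)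

/-- The bound for the number of gaps given by the quadratic forms, and by the fact that all cubic
forms agree to second order up to scalars. -/
theorem evenProfile_quadratic_gaps {n m : ℕ} (hn : 0 < n) (hm : 0 < m) {f : Fin n → PowerSeries ℂ}
    (hf : HasRamificationProfile f (evenProfile n m)) (hfin : (valueSemigroup f)ᶜ.Finite) :
    6 * m + 2 ≤ (valueSemigroup f)ᶜ.ncard + ((n + 2).choose 2 + 1) := by
  have hq : ∀ i, ((2 * m : ℕ) : ℕ∞) ≤ PowerSeries.order (f i) :=
    hf.le_order fun i => by simp [evenProfile]
  -- Only one of the series of orders `2m, 2m + 2, …` is nonzero modulo `t ^ (2m + 2)`; `u` is its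
  -- unit factor.
  obtain ⟨u, a, r, hr⟩ : ∃ (u : PowerSeries ℂ) (a : Fin n → ℂ) (r : Fin n → PowerSeries ℂ),
      ∀ i, f i = PowerSeries.X ^ (2 * m) * (a i • u + PowerSeries.X ^ 2 * r i) := by
    obtain ⟨g, h, -, ho, hfh⟩ :=
      (hasRamificationProfile_iff (evenProfile_injective n m) (evenProfile_pos hm)).1 hf
    have hdvd : ∀ j, ∃ v, h j = PowerSeries.X ^ (evenProfile n m j) * v := fun j =>
      PowerSeries.X_pow_dvd_iff.2 (PowerSeries.order_eq_nat.1 (ho j)).2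
    choose v hv using hdvd
    obtain ⟨n, rfl⟩ := Nat.exists_eq_succ_of_ne_zero hn.ne'
    refine ⟨v 0, fun i => g i 0,
      fun i => ∑ j : Fin n, g i j.succ • (PowerSeries.X ^ (2 * (j : ℕ)) * v j.succ), fun i => ?_⟩
    rw [hfh, Fin.sum_univ_succ, mul_add, Finset.mul_sum, Finset.mul_sum]
    congr 1
    · rw [hv 0]
      simp [evenProfile]
    · refine Finset.sum_congr rfl fun j _ => ?_
      rw [hv j.succ, mul_smul_comm, mul_smul_comm]
      congr 1
      simp only [evenProfile, Fin.val_succ]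
      ring
  let φ : Fin (n + 1) → PowerSeries ℂ := Fin.cons 1 f
  -- Products of two of `1, f₁, …, fₙ` are all the monomials of degree at most two, `(n + 2).choose
  -- 2` in number; `none` stands for the one cubic needed.
  let v : Option (Sym2 (Fin (n + 1))) → PowerSeries ℂ := fun o =>
    o.elim ((PowerSeries.X ^ (2 * m) * u) ^ 3)
      (Sym2.lift ⟨fun i j => φ i * φ j, fun i j => mul_comm _ _⟩)
  have hspan : ∀ i j, φ i * φ j ∈ Submodule.span ℂ (Set.range v) := fun i j =>
    Submodule.subset_span ⟨some s(i, j), rfl⟩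
  have := le_ncard_compl_add hf.1 hfin v (6 * m + 2) ?_
  · simpa [Sym2.card] using this
  intro e
  match he : e.degree with
  | 0 =>
    refine ⟨φ 0 * φ 0, hspan 0 0, ?_⟩
    rw [(Finsupp.degree_eq_zero_iff e).1 he]
    simp [φ]
  | 1 =>
    obtain ⟨i, e', he', h⟩ := exists_prod_pow_eq_mul f he
    refine ⟨φ i.succ * φ 0, hspan _ _, ?_⟩
    rw [h, (Finsupp.degree_eq_zero_iff e').1 he']
    simp [φ]
  | 2 =>
    obtain ⟨i, e', he', h⟩ := exists_prod_pow_eq_mul f he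
    obtain ⟨j, e'', he'', h'⟩ := exists_prod_pow_eq_mul f he'
    refine ⟨φ i.succ * φ j.succ, hspan _ _, ?_⟩
    rw [h, h', (Finsupp.degree_eq_zero_iff e'').1 he'']
    simp [φ]
  | 3 =>
    obtain ⟨i, e', he', h⟩ := exists_prod_pow_eq_mul f he
    obtain ⟨j, e'', he'', h'⟩ := exists_prod_pow_eq_mul f he'
    obtain ⟨l, e₃, he₃, h''⟩ := exists_prod_pow_eq_mul f he''
    refine ⟨(a i * a j * a l) • (PowerSeries.X ^ (2 * m) * u) ^ 3,
      Submodule.smul_mem _ _ (Submodule.subset_span ⟨none, rfl⟩), ?_⟩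
    rw [h, h', h'', (Finsupp.degree_eq_zero_iff e₃).1 he₃, Finsupp.prod_zero_index, mul_one,
      hr i, hr j, hr l]
    simp only [PowerSeries.smul_eq_C_mul, map_mul]
    generalize PowerSeries.C (a i) = A
    generalize PowerSeries.C (a j) = B
    generalize PowerSeries.C (a l) = D
    exact ⟨A * u * (B * u * r l + r j * (D * u + PowerSeries.X ^ 2 * r l)) +
      r i * (B * u + PowerSeries.X ^ 2 * r j) * (D * u + PowerSeries.X ^ 2 * r l), by ring⟩
  -- Degree four and higher has order at least `8m ≥ 6m + 2`, as `m ≥ 1`.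
  | q + 4 =>
    refine ⟨0, zero_mem _, ?_⟩
    rw [sub_zero]
    exact X_pow_dvd_prod_pow hq e (by rw [he]; nlinarith)

/-- The codimension of the space of germs with an even ramification profile is less than
`(n - 2) * g`. -/
theorem sum_evenProfile_lt {n m g : ℕ} (hn : 4 ≤ n) (hm : (7 / 6 : ℝ) * n + 26 / 9 < m)
    (h₁ : 4 * m ≤ g + (n + 1)) (h₂ : 6 * m + 2 ≤ g + ((n + 2).choose 2 + 1)) :
    ∑ i : Fin n, (evenProfile n m i - ((i : ℕ) + 1)) < (n - 2) * g := by
  have hm' : 21 * n + 52 < 18 * m := by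
    have : (21 * n + 52 : ℝ) < 18 * m := by linarith
    exact_mod_cast this
  have hsum : (∑ i : Fin n, (evenProfile n m i - ((i : ℕ) + 1))) * 2 + 2 * n =
      4 * m * n + n * (n - 1) := by
    have h : ∀ i : Fin n, evenProfile n m i - ((i : ℕ) + 1) + 1 = 2 * m + i := fun i => by
      simp only [evenProfile]
      omega
    have h' : ∑ i : Fin n, (evenProfile n m i - ((i : ℕ) + 1)) + n = ∑ i : Fin n, (2 * m + (i : ℕ)) := by
      rw [← Finset.sum_congr rfl fun i _ => h i, Finset.sum_add_distrib]
      simp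
    have h'' := Finset.sum_range_id_mul_two n
    rw [Finset.sum_add_distrib, Finset.sum_const, Finset.card_univ, Fintype.card_fin,
      Fin.sum_univ_eq_sum_range (fun i => i) n, smul_eq_mul] at h'
    nlinarith
  obtain ⟨p, rfl⟩ := Nat.exists_eq_add_of_le hn
  -- The sum equals `2mn + n(n - 3)/2`. For `n = 4` and `n = 5` the linear bound is too weak and
  -- `h₂` is needed; from `n = 6` on `h₁` suffices.
  rcases p with _ | _ | p
  · norm_num [Nat.choose] at *
    omega
  · norm_num [Nat.choose] at *
    omega
  · have e1 : 4 + (p + 1 + 1) - 2 = p + 4 := by omega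
    have e2 : 4 + (p + 1 + 1) - 1 = p + 5 := by omega
    rw [e2] at hsum
    rw [e1]
    nlinarith

/-! ### Codimension and the number of equations -/

/-- If `J` is generated by the finite set `s` and some nonempty basic open subset of the zero locus
of `J` lies in the Zariski closure of `Y`, then the codimension of `Y` is at most `#s`. -/
theorem codimension_le_card {σ : Type} [Finite σ] {X Y : Set (σ → ℂ)} (hYX : Y ⊆ X)
    (s : Finset (MvPolynomial σ ℂ)) (h : MvPolynomial σ ℂ) (a₀ : σ → ℂ)
    (ha₀ : ∀ p ∈ s, MvPolynomial.eval a₀ p = 0) (hh : MvPolynomial.eval a₀ h ≠ 0)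
    (hY : ∀ a : σ → ℂ, (∀ p ∈ s, MvPolynomial.eval a p = 0) → MvPolynomial.eval a h ≠ 0 →
      ∀ H ∈ MvPolynomial.vanishingIdeal ℂ Y, MvPolynomial.eval a H = 0) :
    codimension X Y ≤ s.card := by
  classical
  set J : Ideal (MvPolynomial σ ℂ) := Ideal.span s with hJ
  have hJm : J ≤ RingHom.ker (MvPolynomial.eval a₀) := by
    rw [hJ, Ideal.span_le]
    exact ha₀
  have : (RingHom.ker (MvPolynomial.eval a₀)).IsPrime := RingHom.ker_isPrime _
  -- `P` is an irreducible component of the zero locus of `J` through `a₀`, so `h` does not vanish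
  -- identically on it.
  obtain ⟨P, hP, hPm⟩ := Ideal.exists_minimalPrimes_le hJm
  have hPprime : P.IsPrime := hP.1.1
  have hhP : h ∉ P := fun hmem => hh (hPm hmem)
  have hYP : MvPolynomial.vanishingIdeal ℂ Y ≤ P := by
    intro H hH
    -- Off `h = 0` the factor `H` vanishes on the zero locus, so the product vanishes on all of it;
    -- the Nullstellensatz puts it in the radical of `J`, hence in `P`.
    have hmem : h * H ∈ MvPolynomial.vanishingIdeal ℂ (MvPolynomial.zeroLocus ℂ J) := by
      rw [MvPolynomial.mem_vanishingIdeal_iff]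
      intro a ha
      rw [MvPolynomial.mem_zeroLocus_iff] at ha
      rw [map_mul]
      by_cases h0 : MvPolynomial.aeval a h = 0
      · rw [h0, zero_mul]
      · have := hY a (fun p hp => by simpa using ha p (Ideal.subset_span hp)) (by simpa using h0) H hH
        rw [show MvPolynomial.aeval a H = 0 by simpa using this, mul_zero]
    rw [MvPolynomial.vanishingIdeal_zeroLocus_eq_radical] at hmem
    have := (hPprime.radical_le_iff.2 hP.1.2) hmem
    exact (hPprime.mem_or_mem this).resolve_left hhP
  have hXP : MvPolynomial.vanishingIdeal ℂ X ≤ P :=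
    (MvPolynomial.vanishingIdeal_anti_mono hYX).trans hYP
  set φ := Ideal.Quotient.mk (MvPolynomial.vanishingIdeal ℂ X) with hφ
  have hmin : P.map φ ∈ (Ideal.span (s.image φ : Set _)).minimalPrimes := by
    have hmap : Ideal.span (s.image φ : Set _) = J.map φ := by
      rw [hJ, Ideal.map_span, Finset.coe_image]
    rw [hmap, Ideal.minimalPrimes_map_of_surjective Ideal.Quotient.mk_surjective]
    refine ⟨P, ⟨⟨hPprime, sup_le hP.1.2 ?_⟩, fun Q hQ hQP => ?_⟩, rfl⟩
    · rwa [Ideal.mk_ker]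
    · exact hP.2 ⟨hQ.1, le_sup_left.trans hQ.2⟩ hQP
  calc codimension X Y ≤ (P.map φ).height := Ideal.height_mono (Ideal.map_mono hYP)
    _ ≤ (s.image φ).card := Ideal.height_le_card_of_mem_minimalPrimes_span_finset hmin
    _ ≤ s.card := by exact_mod_cast Finset.card_image_le

/-! ### Generic top coefficients make the map an embedding away from `x = 0` -/

/-- A point that is generic over a countable field containing given constants. -/
theorem exists_algebraicIndependent {τ : Type} [Finite τ] (H : MvPolynomial τ ℂ) (hH : H ≠ 0)
    (Z : Set ℂ) (hZ : Z.Countable) :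
    ∃ K : Subfield ℂ, Z ⊆ K ∧ ∃ x : τ → ℂ, AlgebraicIndependent K x ∧
      MvPolynomial.eval x H ≠ 0 := by
  -- Adjoining the coefficients of `H` keeps `K` countable, so `ℂ` has infinite transcendence degree
  -- over it, and `H` is defined over `K`, so it cannot vanish at an independent point.
  let K : Subfield ℂ := Subfield.closure (Z ∪ Set.range fun e => H.coeff e)
  have hHK : Set.range (fun e => H.coeff e) ⊆ (K : Set ℂ) :=
    Set.subset_union_right.trans Subfield.subset_closure
  have hcount : (Z ∪ Set.range fun e => H.coeff e).Countable := by
    refine hZ.union (Set.countable_range _)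
  have hK : Cardinal.mk K ≤ Cardinal.aleph0 :=
    (Subfield.cardinalMk_closure_le_max _).trans (max_le hcount.le_aleph0 le_rfl)
  refine ⟨K, Set.subset_union_left.trans Subfield.subset_closure, ?_⟩
  obtain ⟨ι, b, hb⟩ := exists_isTranscendenceBasis' K ℂ
  have hcard := IsAlgClosed.cardinal_eq_cardinal_transcendence_basis_of_aleph0_lt' b hb hK
    (by rw [Cardinal.mk_complex]; exact Cardinal.aleph0_lt_continuum)
  have : Infinite ι := by
    rw [Cardinal.infinite_iff, ← hcard, Cardinal.mk_complex]
    exact Cardinal.aleph0_le_continuum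
  obtain ⟨n, ⟨e⟩⟩ := Finite.exists_equiv_fin τ
  have hx : AlgebraicIndependent K (fun t => b (Infinite.natEmbedding ι (e t))) :=
    hb.1.comp _ ((Infinite.natEmbedding ι).injective.comp
      (Fin.val_injective.comp e.injective))
  refine ⟨_, hx, fun h0 => hH ?_⟩
  obtain ⟨H', hH'⟩ : H ∈ Set.range (MvPolynomial.map (algebraMap K ℂ)) := by
    rw [MvPolynomial.mem_range_map_iff_coeffs_subset]
    intro c hc
    obtain ⟨e, -, rfl⟩ := MvPolynomial.mem_coeffs_iff.1 hc
    exact ⟨⟨_, hHK ⟨e, rfl⟩⟩, rfl⟩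
  rw [← hH'] at h0 ⊢
  rw [MvPolynomial.eval_map, ← MvPolynomial.aeval_def] at h0
  rw [hx.eq_zero_of_aeval_eq_zero _ h0, map_zero]

/-- Generic coordinates satisfy no relation that has coefficients depending on three parameters. -/
theorem relation_ne_zero {K : Subfield ℂ} {ι : Type} [Fintype ι] (hι : 4 ≤ Fintype.card ι)
    {x : ι ⊕ ι → ℂ} (hx : AlgebraicIndependent K x) (y : Fin 3 → ℂ) {α : ι → ℂ} {β γ : ℂ}
    (hα : ∀ i, α i ∈ Algebra.adjoin K (Set.range y)) (hβ : β ∈ Algebra.adjoin K (Set.range y))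
    (hγ : γ ∈ Algebra.adjoin K (Set.range y)) (hβγ : β ≠ 0 ∨ γ ≠ 0)
    (hrel : ∀ i, α i + β * x (Sum.inl i) + γ * x (Sum.inr i) = 0) : False := by
  classical
  wlog hβ0 : β ≠ 0 generalizing x β γ
  · refine this (x := x ∘ Sum.swap) (hx.comp _ (Equiv.sumComm ι ι).injective) hγ hβ hβγ.symm
      (fun i => ?_) (hβγ.resolve_left hβ0)
    have := hrel i
    simp only [Function.comp_apply, Sum.swap_inl, Sum.swap_inr]
    linear_combination this
  let M := AlgebraicIndependent.matroid K ℂ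
  -- Since `β ≠ 0`, the relations make each `x (Sum.inl i)` algebraic over `G`. Then `2 * #ι`
  -- independent numbers would depend on `3 + #ι`, impossible for `#ι ≥ 4`.
  let G : Set ℂ := Set.range y ∪ Set.range fun i => x (Sum.inr i)
  let A := Algebra.adjoin K G
  have hmem : ∀ z ∈ A, IsAlgebraic A z := fun z hz => isAlgebraic_algebraMap (⟨z, hz⟩ : A)
  have hyA : Algebra.adjoin K (Set.range y) ≤ A := Algebra.adjoin_mono Set.subset_union_left
  have hinr : ∀ i, x (Sum.inr i) ∈ A := fun i => Algebra.subset_adjoin (Or.inr ⟨i, rfl⟩)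
  have hsub : Set.range x ⊆ M.closure G := by
    rw [AlgebraicIndependent.matroid_closure_eq]
    rintro _ ⟨i | i, rfl⟩
    · have e : x (Sum.inl i) = -(α i + γ * x (Sum.inr i)) * β⁻¹ := by
        field_simp
        linear_combination hrel i
      change IsAlgebraic A _
      rw [e]
      exact (hmem _ (neg_mem (add_mem (hyA (hα i)) (mul_mem (hyA hγ) (hinr i))))).mul
        (hmem _ (hyA hβ)).inv
    · exact hmem _ (hinr i)
  have hind : M.Indep (Set.range x) := by
    rw [AlgebraicIndependent.matroid_indep_iff]
    exact hx.coe_range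
  have h1 := hind.encard_le_eRk_of_subset hsub
  rw [Matroid.eRk_closure_eq] at h1
  have h2 := h1.trans (M.eRk_le_encard G)
  have h3 : G.encard ≤ (3 + Fintype.card ι : ℕ) := by
    refine (Set.encard_union_le _ _).trans ?_
    rw [Nat.cast_add]
    refine add_le_add ?_ ?_
    · rw [← Set.image_univ]
      refine (Set.encard_image_le _ _).trans ?_
      simp [Set.encard_univ]
    · rw [← Set.image_univ]
      refine (Set.encard_image_le _ _).trans ?_
      simp [Set.encard_univ]
  have h4 : (Set.range x).encard = (Fintype.card ι + Fintype.card ι : ℕ) := by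
    rw [← Set.image_univ, hx.injective.encard_image]
    simp [Set.encard_univ]
  rw [h4] at h2
  have := h2.trans h3
  norm_cast at this
  omega

theorem point_cases (P : Projectivization ℂ (Fin 2 → ℂ)) :
    (∃ y : ℂ, ∃ h : (![1, y] : Fin 2 → ℂ) ≠ 0, P = Projectivization.mk ℂ ![1, y] h) ∨
      ∃ h : (![0, 1] : Fin 2 → ℂ) ≠ 0, P = Projectivization.mk ℂ ![0, 1] h := by
  induction P using Projectivization.ind with
  | h v hv =>
    by_cases h0 : v 0 = 0
    · refine Or.inr ⟨fun h => by simpa using congrFun h 1, ?_⟩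
      rw [Projectivization.mk_eq_mk_iff']
      refine ⟨v 1, ?_⟩
      funext l
      fin_cases l <;> simp [h0]
    · refine Or.inl ⟨v 1 / v 0, fun h => by simpa using congrFun h 0, ?_⟩
      rw [Projectivization.mk_eq_mk_iff']
      refine ⟨v 0, ?_⟩
      funext l
      fin_cases l <;> simp [mul_div_cancel₀ _ h0]

/-- The last two coefficients of the forms are generic over a field containing the others. -/
structure IsGenericOver {n d : ℕ} (a : Coeffs n d) (K : Subfield ℂ)
    (x : Fin (n + 1) ⊕ Fin (n + 1) → ℂ) : Prop where
  two_le : 2 ≤ d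
  indep : AlgebraicIndependent K x
  mem : ∀ i (j : Fin (d + 1)), (j : ℕ) < d - 1 → a (i, j) ∈ K
  last : ∀ i, a (i, Fin.last d) = x (Sum.inl i)
  penult : ∀ i, a (i, ⟨d - 1, by omega⟩) = x (Sum.inr i)

/-- The indices of all but the last two coefficients. -/
def lowIndices (d : ℕ) : Finset (Fin (d + 1)) := Finset.univ.filter fun j => (j : ℕ) < d - 1

theorem sum_eq_lowIndices {d : ℕ} (hd : 2 ≤ d) {A : Type*} [AddCommMonoid A]
    (f : Fin (d + 1) → A) :
    ∑ j, f j = ∑ j ∈ lowIndices d, f j + f ⟨d - 1, by omega⟩ + f (Fin.last d) := by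
  obtain ⟨e, rfl⟩ := Nat.exists_eq_add_of_le' hd
  have hlow : lowIndices (e + 2) = Finset.univ.image (fun i : Fin (e + 1) => i.castSucc.castSucc) := by
    ext j
    simp only [lowIndices, Finset.mem_filter, Finset.mem_univ, true_and, Finset.mem_image]
    constructor
    · intro h
      exact ⟨⟨j, by omega⟩, rfl⟩
    · rintro ⟨i, rfl⟩
      simp
      omega
  rw [Fin.sum_univ_castSucc, Fin.sum_univ_castSucc, hlow, Finset.sum_image]
  · rfl
  · intro i _ j _ h
    simpa using h

theorem formEval_eq {n d : ℕ} {a : Coeffs n d} {K : Subfield ℂ} {x : Fin (n + 1) ⊕ Fin (n + 1) → ℂ}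
    (ha : IsGenericOver a K x) {A : Type} [CommRing A] [Algebra ℂ A] (u : Fin 2 → A)
    (i : Fin (n + 1)) :
    formEval a u i = ∑ j ∈ lowIndices d, a (i, j) • (u 0 ^ (j : ℕ) * u 1 ^ (d - (j : ℕ))) +
      x (Sum.inr i) • (u 0 ^ (d - 1) * u 1) + x (Sum.inl i) • u 0 ^ d := by
  rw [formEval, sum_eq_lowIndices ha.two_le, ha.last, ha.penult]
  have : d - (d - 1) = 1 := by have := ha.two_le; omega
  simp [this]

theorem lowSum_mem {n d : ℕ} {a : Coeffs n d} {K : Subfield ℂ}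
    {x : Fin (n + 1) ⊕ Fin (n + 1) → ℂ} (ha : IsGenericOver a K x) (i : Fin (n + 1))
    {B : Subalgebra K ℂ} {z : Fin (d + 1) → ℂ} (hz : ∀ j, z j ∈ B) :
    ∑ j ∈ lowIndices d, a (i, j) * z j ∈ B := by
  refine sum_mem fun j hj => mul_mem ?_ (hz j)
  exact B.algebraMap_mem (⟨a (i, j), ha.mem i j (Finset.mem_filter.1 hj).2⟩ : K)

theorem formEval_zero_one {n d : ℕ} (a : Coeffs n d) (c : ℂ) (i : Fin (n + 1)) :
    formEval a ![0, c] i = a (i, 0) * c ^ d := by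
  rw [formEval, Fin.sum_univ_succ]
  simp

/-- A common zero with `u 0 ≠ 0` is a relation in the two parameters `u 0, u 1`; the third is padded
by `0`. At `u 0 = 0` only the coefficients of `y ^ d` matter. -/
theorem IsGenericOver.basePointFree {n d : ℕ} (hn : 3 ≤ n) {a : Coeffs n d} {K : Subfield ℂ}
    {x : Fin (n + 1) ⊕ Fin (n + 1) → ℂ} (ha : IsGenericOver a K x) (h0 : ∃ i, a (i, 0) ≠ 0) :
    BasePointFree a := by
  intro u hu hzero
  by_cases hu0 : u 0 = 0
  · obtain ⟨i, hi⟩ := h0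
    have hu' : u = ![0, u 1] := by
      funext l
      fin_cases l <;> simp [hu0]
    have hu1 : u 1 ≠ 0 := fun h => hu (by rw [hu', h]; simp)
    have := congrFun hzero i
    rw [hu', formEval_zero_one] at this
    exact mul_ne_zero hi (pow_ne_zero _ hu1) this
  · have hmem : ∀ l, u l ∈ Algebra.adjoin K (Set.range ![u 0, u 1, 0]) := fun l =>
      Algebra.subset_adjoin (by fin_cases l <;> simp)
    refine relation_ne_zero (by simpa using hn) ha.indep ![u 0, u 1, 0]
      (α := fun i => ∑ j ∈ lowIndices d, a (i, j) * (u 0 ^ (j : ℕ) * u 1 ^ (d - (j : ℕ))))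
      (β := u 0 ^ d) (γ := u 0 ^ (d - 1) * u 1) ?_ ?_ ?_ (Or.inl (pow_ne_zero _ hu0)) ?_
    · exact fun i => lowSum_mem ha i fun j => mul_mem (pow_mem (hmem 0) _) (pow_mem (hmem 1) _)
    · exact pow_mem (hmem 0) _
    · exact mul_mem (pow_mem (hmem 0) _) (hmem 1)
    · intro i
      have := congrFun hzero i
      rw [formEval_eq ha] at this
      simp only [smul_eq_mul, Pi.zero_apply] at this
      linear_combination this

/-- If `(1 : y)` and `(1 : y')` have the same image, the parameters are `y`, `y'` and the
proportionality factor `c`. The coefficients `1 - c` and `y - c * y'` vanish together only if `y =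
y'`. -/
theorem IsGenericOver.injective {n d : ℕ} (hn : 3 ≤ n) {a : Coeffs n d} {K : Subfield ℂ}
    {x : Fin (n + 1) ⊕ Fin (n + 1) → ℂ} (ha : IsGenericOver a K x) (hbpf : BasePointFree a) :
    Function.Injective (toProjMap a hbpf) := by
  have hd := ha.two_le
  have key : ∀ (y : ℂ) (h : (![1, y] : Fin 2 → ℂ) ≠ 0) (h' : (![0, 1] : Fin 2 → ℂ) ≠ 0),
      toProjMap a hbpf (Projectivization.mk ℂ ![1, y] h) ≠
        toProjMap a hbpf (Projectivization.mk ℂ ![0, 1] h') := by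
    intro y h h' heq
    obtain ⟨c, hc⟩ := (Projectivization.mk_eq_mk_iff' ℂ _ _ _ _).1 heq
    have hy : y ∈ Algebra.adjoin K (Set.range ![y, c, 0]) := Algebra.subset_adjoin (by simp)
    have hcm : c ∈ Algebra.adjoin K (Set.range ![y, c, 0]) := Algebra.subset_adjoin (by simp)
    refine relation_ne_zero (by simpa using hn) ha.indep ![y, c, 0]
      (α := fun i => ∑ j ∈ lowIndices d, a (i, j) * y ^ (d - (j : ℕ)) - c * a (i, 0))
      (β := 1) (γ := y) ?_ (one_mem _) hy (Or.inl one_ne_zero) ?_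
    · exact fun i => sub_mem (lowSum_mem ha i fun j => pow_mem hy _)
        (mul_mem hcm (Subalgebra.algebraMap_mem _
          (⟨a (i, 0), ha.mem i 0 (by simp; omega)⟩ : K)))
    · intro i
      have := congrFun hc i
      simp only [Pi.smul_apply, formEval_zero_one, smul_eq_mul] at this
      rw [formEval_eq ha] at this
      simp only [Matrix.cons_val_zero, Matrix.cons_val_one, one_pow, one_mul,
        mul_one, smul_eq_mul] at this
      linear_combination -this
  intro P Q hPQ
  rcases point_cases P with ⟨y, hy, rfl⟩ | ⟨hp, rfl⟩ <;>
    rcases point_cases Q with ⟨y', hy', rfl⟩ | ⟨hq, rfl⟩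
  · obtain ⟨c, hc⟩ := (Projectivization.mk_eq_mk_iff' ℂ _ _ _ _).1 hPQ
    by_cases hyy : y = y'
    · subst hyy
      rfl
    exfalso
    have h0 : y ∈ Algebra.adjoin K (Set.range ![y, y', c]) := Algebra.subset_adjoin (by simp)
    have h1 : y' ∈ Algebra.adjoin K (Set.range ![y, y', c]) := Algebra.subset_adjoin (by simp)
    have h2 : c ∈ Algebra.adjoin K (Set.range ![y, y', c]) := Algebra.subset_adjoin (by simp)
    refine relation_ne_zero (by simpa using hn) ha.indep ![y, y', c]
      (α := fun i => ∑ j ∈ lowIndices d, a (i, j) * y ^ (d - (j : ℕ)) -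
        c * ∑ j ∈ lowIndices d, a (i, j) * y' ^ (d - (j : ℕ)))
      (β := 1 - c) (γ := y - c * y') ?_ (sub_mem (one_mem _) h2) (sub_mem h0 (mul_mem h2 h1)) ?_ ?_
    · exact fun i => sub_mem (lowSum_mem ha i fun j => pow_mem h0 _)
        (mul_mem h2 (lowSum_mem ha i fun j => pow_mem h1 _))
    · by_contra! h
      have hc1 : c = 1 := by linear_combination -h.1
      rw [hc1] at h
      exact hyy (by linear_combination h.2)
    · intro i
      have := congrFun hc i
      simp only [Pi.smul_apply, smul_eq_mul] at this
      rw [formEval_eq ha, formEval_eq ha] at this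
      simp only [Matrix.cons_val_zero, Matrix.cons_val_one, one_pow, one_mul,
        mul_one, smul_eq_mul] at this
      linear_combination -this
  · exact absurd hPQ (key y hy hq)
  · exact absurd hPQ.symm (key y' hy' hp)
  · rfl

theorem valueSemigroup_eq_univ {n : ℕ} {f : Fin n → PowerSeries ℂ}
    (hf : ∀ i, PowerSeries.constantCoeff (f i) = 0) (h1 : ∃ i, PowerSeries.coeff 1 (f i) ≠ 0) :
    valueSemigroup f = Set.univ := by
  obtain ⟨i, hi⟩ := h1
  have : 1 ∈ valueSemigroup f := by
    rw [mem_valueSemigroup_iff hf]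
    refine ⟨MvPolynomial.X i, ?_⟩
    rw [MvPolynomial.aeval_X, PowerSeries.order_eq_nat]
    refine ⟨hi, fun j hj => ?_⟩
    obtain rfl : j = 0 := by omega
    simpa using hf i
  refine Set.eq_univ_of_forall fun s => ?_
  simpa using nsmul_mem_valueSemigroup hf this s

theorem constantCoeff_affineGerm {n : ℕ} (F : Fin (n + 1) → PowerSeries ℂ) (j : Fin (n + 1))
    (i : Fin n) : PowerSeries.constantCoeff (affineGerm F j i) = 0 := by
  simp [affineGerm]

theorem constantCoeff_expansion {n d : ℕ} (a : Coeffs n d) (u w : Fin 2 → ℂ) (i : Fin (n + 1)) :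
    PowerSeries.constantCoeff (expansion a u w i) = formEval a u i := by
  simp [expansion, formEval, map_sum, PowerSeries.constantCoeff_smul]

theorem coeff_one_C_add_X_pow (y : ℂ) (k : ℕ) :
    PowerSeries.coeff 1 ((PowerSeries.C y + PowerSeries.X) ^ k : PowerSeries ℂ) =
      k * y ^ (k - 1) := by
  induction k with
  | zero => simp [PowerSeries.coeff_one]
  | succ k ih =>
    rw [pow_succ, PowerSeries.coeff_mul, Finset.Nat.antidiagonal_succ]
    simp only [Finset.Nat.antidiagonal_zero, Finset.map_singleton, Finset.sum_cons,
      Finset.sum_singleton]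
    simp only [Function.Embedding.prodMap, Function.Embedding.coeFn_mk, Prod.map, ih]
    rcases k with _ | k
    · simp
    · simp
      ring

theorem exists_coeff_one_affineGerm_ne_zero {n : ℕ} {F : Fin (n + 1) → PowerSeries ℂ}
    {j : Fin (n + 1)} (hj : PowerSeries.constantCoeff (F j) ≠ 0)
    (h : ¬ ∃ μ : ℂ, ∀ i, PowerSeries.coeff 1 (F i) = μ * PowerSeries.constantCoeff (F i)) :
    ∃ i, PowerSeries.coeff 1 (affineGerm F j i) ≠ 0 := by
  by_contra! hall
  refine h ⟨PowerSeries.coeff 1 (F j) / PowerSeries.constantCoeff (F j), fun i => ?_⟩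
  have hq : ∀ i, ∃ q : PowerSeries ℂ, F i = q * F j ∧ PowerSeries.coeff 1 q = 0 := by
    intro i
    rcases Fin.eq_self_or_eq_succAbove j i with rfl | ⟨l, rfl⟩
    · exact ⟨1, by simp, by simp [PowerSeries.coeff_one]⟩
    · refine ⟨F (j.succAbove l) * (F j)⁻¹, ?_, ?_⟩
      · rw [mul_assoc, PowerSeries.inv_mul_cancel _ hj, mul_one]
      · simpa [affineGerm, PowerSeries.coeff_C] using hall l
  obtain ⟨q, hq, hq1⟩ := hq i
  rw [hq, PowerSeries.coeff_mul, map_mul, Finset.Nat.antidiagonal_succ]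
  simp [hq1]
  field_simp

/-- If the branch were not immersed, the derivative of the forms along `y` would be `μ` times their
value: a relation in `y` and `μ` whose coefficients `-μ` and `1 - μ * y` cannot both vanish. -/
theorem IsGenericOver.hasValueSemigroupAt_univ {n d : ℕ} (hn : 3 ≤ n) {a : Coeffs n d}
    {K : Subfield ℂ} {x : Fin (n + 1) ⊕ Fin (n + 1) → ℂ} (ha : IsGenericOver a K x)
    (hbpf : BasePointFree a) (y : ℂ) (h : (![1, y] : Fin 2 → ℂ) ≠ 0) :
    HasValueSemigroupAt a (Projectivization.mk ℂ ![1, y] h) Set.univ := by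
  obtain ⟨j, hj⟩ := Function.ne_iff.1 (hbpf _ h)
  refine ⟨![1, y], ![0, 1], h, j, rfl, ?_, hj, ?_⟩
  · rw [LinearIndependent.pair_iff]
    intro s t hst
    have h0 := congrFun hst 0
    have h1 := congrFun hst 1
    simp only [Pi.add_apply, Pi.smul_apply, Matrix.cons_val_zero, Matrix.cons_val_one,
      smul_eq_mul, mul_one, mul_zero, add_zero, Pi.zero_apply] at h0 h1
    subst h0
    exact ⟨rfl, by simpa using h1⟩
  refine valueSemigroup_eq_univ (constantCoeff_affineGerm _ _)
    (exists_coeff_one_affineGerm_ne_zero (by rwa [constantCoeff_expansion]) ?_)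
  rintro ⟨μ, hμ⟩
  have h0 : y ∈ Algebra.adjoin K (Set.range ![y, μ, 0]) := Algebra.subset_adjoin (by simp)
  have h1 : μ ∈ Algebra.adjoin K (Set.range ![y, μ, 0]) := Algebra.subset_adjoin (by simp)
  refine relation_ne_zero (by simpa using hn) ha.indep ![y, μ, 0]
    (α := fun i => ∑ j ∈ lowIndices d, a (i, j) *
      (((d - (j : ℕ) : ℕ) : ℂ) * y ^ (d - (j : ℕ) - 1)) -
      μ * ∑ j ∈ lowIndices d, a (i, j) * y ^ (d - (j : ℕ)))
    (β := -μ) (γ := 1 - μ * y) ?_ (neg_mem h1) (sub_mem (one_mem _) (mul_mem h1 h0)) ?_ ?_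
  · exact fun i => sub_mem
      (lowSum_mem ha i fun j => mul_mem (natCast_mem _ _) (pow_mem h0 _))
      (mul_mem h1 (lowSum_mem ha i fun j => pow_mem h0 _))
  · by_contra! h
    have : μ = 0 := by simpa using h.1
    rw [this] at h
    simpa using h.2
  · intro i
    have := hμ i
    rw [constantCoeff_expansion, formEval_eq ha, expansion, formEval_eq ha] at this
    simp only [Matrix.cons_val_zero, Matrix.cons_val_one, one_pow, one_mul, zero_smul, add_zero,
      mul_one, one_smul, smul_eq_mul, map_one, map_add, map_sum, PowerSeries.coeff_smul,
      coeff_one_C_add_X_pow, PowerSeries.coeff_one_X, PowerSeries.coeff_one,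
      PowerSeries.coeff_C] at this
    simp only [one_ne_zero, if_false] at this
    linear_combination this

/-! ### Row reduction with prescribed pivots: equations for a ramification profile -/

/-- The matrix with columns `k c`, `c < i`, of `b`, completed by unit vectors. -/
def pivotMatrix {N : ℕ} {A : Type*} [CommRing A] (k : Fin N → ℕ) (b : Fin N → ℕ → A) (i : Fin N) :
    Matrix (Fin N) (Fin N) A :=
  Matrix.of fun r c => if c < i then b r (k c) else if r = c then 1 else 0

/-- The minor of `b` with rows `0, …, i` and columns `k 0, …, k (i - 1), j`. -/
def pivotMinor {N : ℕ} {A : Type*} [CommRing A] (k : Fin N → ℕ) (b : Fin N → ℕ → A) (i : Fin N)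
    (j : ℕ) : A :=
  ((pivotMatrix k b i).updateCol i fun r => b r j).det

/-- The product of the minors whose nonvanishing allows the row reduction with pivots `k`. -/
def pivotProd {N : ℕ} {A : Type*} [CommRing A] (k : Fin N → ℕ) (b : Fin N → ℕ → A) : A :=
  ∏ i, (pivotMatrix k b i).det * pivotMinor k b i (k i)

section pivot

variable {N : ℕ} {A B : Type*} [CommRing A] [CommRing B] (k : Fin N → ℕ) (b : Fin N → ℕ → A)

theorem map_det_pivotMatrix (φ : A →+* B) (i : Fin N) :
    φ (pivotMatrix k b i).det = (pivotMatrix k (fun r l => φ (b r l)) i).det := by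
  rw [RingHom.map_det]
  congr 1
  ext r c
  simp only [pivotMatrix, RingHom.mapMatrix_apply, Matrix.map_apply, Matrix.of_apply]
  split_ifs <;> simp

theorem map_pivotMinor (φ : A →+* B) (i : Fin N) (j : ℕ) :
    φ (pivotMinor k b i j) = pivotMinor k (fun r l => φ (b r l)) i j := by
  rw [pivotMinor, RingHom.map_det, pivotMinor]
  congr 1
  ext r c
  simp only [pivotMatrix, RingHom.mapMatrix_apply, Matrix.map_apply, Matrix.of_apply,
    Matrix.updateCol_apply]
  split_ifs <;> simp

theorem map_pivotProd (φ : A →+* B) :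
    φ (pivotProd k b) = pivotProd k (fun r l => φ (b r l)) := by
  simp only [pivotProd, map_prod, map_mul, map_det_pivotMatrix, map_pivotMinor]

variable {k b}

theorem pivotMatrix_congr {b' : Fin N → ℕ → A} {d : ℕ} (hk : ∀ i, k i ≤ d)
    (hb : ∀ r, ∀ l ≤ d, b r l = b' r l) (i : Fin N) : pivotMatrix k b i = pivotMatrix k b' i := by
  ext r c
  simp only [pivotMatrix, Matrix.of_apply, hb r _ (hk c)]

theorem pivotMinor_congr {b' : Fin N → ℕ → A} {d : ℕ} (hk : ∀ i, k i ≤ d)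
    (hb : ∀ r, ∀ l ≤ d, b r l = b' r l) (i : Fin N) {j : ℕ} (hj : j ≤ d) :
    pivotMinor k b i j = pivotMinor k b' i j := by
  rw [pivotMinor, pivotMinor, pivotMatrix_congr hk hb i]
  congr 2
  funext r
  exact hb r j hj

theorem pivotProd_congr {b' : Fin N → ℕ → A} {d : ℕ} (hk : ∀ i, k i ≤ d)
    (hb : ∀ r, ∀ l ≤ d, b r l = b' r l) : pivotProd k b = pivotProd k b' :=
  Finset.prod_congr rfl fun i _ => by
    rw [pivotMatrix_congr hk hb i, pivotMinor_congr hk hb i (hk i)]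

/-- Expansion along the column `i`: its cofactors do not depend on `j`, so the minors for varying
`j` are the coefficients of one fixed combination of the rows. -/
theorem pivotMinor_eq_sum (i : Fin N) (j : ℕ) :
    pivotMinor k b i j = ∑ r, (pivotMatrix k b i).adjugate i r * b r j := by
  rw [pivotMinor, ← Matrix.cramer_apply, Matrix.cramer_eq_adjugate_mulVec]
  rfl

theorem pivotMinor_pivot {i c : Fin N} (hc : c < i) : pivotMinor k b i (k c) = 0 := by
  refine Matrix.det_zero_of_column_eq hc.ne fun r => ?_
  simp [hc.ne, pivotMatrix, hc]

theorem adjugate_pivotMatrix_eq_det (i r : Fin N) :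
    (pivotMatrix k b i).adjugate i r =
      ((pivotMatrix k b i).updateCol i (Pi.single r 1)).det := by
  rw [← Matrix.cramer_apply, Matrix.cramer_eq_adjugate_mulVec, Matrix.mulVec_single_one]
  rfl

theorem adjugate_pivotMatrix_self (i : Fin N) :
    (pivotMatrix k b i).adjugate i i = (pivotMatrix k b i).det := by
  rw [adjugate_pivotMatrix_eq_det]
  congr 1
  ext r c
  rw [Matrix.updateCol_apply]
  split_ifs with h
  · subst h
    simp [pivotMatrix, Pi.single_apply]
  · rfl

theorem adjugate_pivotMatrix_of_lt {i r : Fin N} (h : i < r) :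
    (pivotMatrix k b i).adjugate i r = 0 := by
  rw [adjugate_pivotMatrix_eq_det]
  refine Matrix.det_zero_of_column_eq h.ne fun s => ?_
  simp [h.ne', pivotMatrix, h.not_gt, Pi.single_apply]

end pivot

/-- The series `F`, reduced with pivots `k`. -/
noncomputable def reducedSeries {N : ℕ} (k : Fin N → ℕ) (F : Fin N → PowerSeries ℂ) (i : Fin N) :
    PowerSeries ℂ :=
  ∑ r, (pivotMatrix k (fun r l => PowerSeries.coeff l (F r)) i).adjugate i r • F r

section reduced

variable {N : ℕ} {k : Fin N → ℕ} {F : Fin N → PowerSeries ℂ}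

theorem coeff_reducedSeries (i : Fin N) (j : ℕ) :
    PowerSeries.coeff j (reducedSeries k F i) =
      pivotMinor k (fun r l => PowerSeries.coeff l (F r)) i j := by
  rw [pivotMinor_eq_sum, reducedSeries, map_sum]
  simp

/-- The cofactor matrix is lower triangular with the minors `(pivotMatrix k b i).det` on its
diagonal, so it is invertible when these are nonzero. -/
theorem span_reducedSeries (hF : pivotProd k (fun r l => PowerSeries.coeff l (F r)) ≠ 0) :
    Submodule.span ℂ (Set.range (reducedSeries k F)) = Submodule.span ℂ (Set.range F) := by
  refine span_range_eq_of_det_ne_zero (Matrix.of fun i r =>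
    (pivotMatrix k (fun r l => PowerSeries.coeff l (F r)) i).adjugate i r) ?_ fun i => rfl
  rw [Matrix.det_of_isLowerTriangular]
  · refine Finset.prod_ne_zero_iff.2 fun i _ => ?_
    rw [Matrix.of_apply, adjugate_pivotMatrix_self]
    exact left_ne_zero_of_mul (Finset.prod_ne_zero_iff.1 hF i (Finset.mem_univ _))
  · intro i r h
    exact adjugate_pivotMatrix_of_lt h

theorem order_reducedSeries (hF : pivotProd k (fun r l => PowerSeries.coeff l (F r)) ≠ 0)
    (h : ∀ i, ∀ j < k i, (∀ c < i, j ≠ k c) →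
      pivotMinor k (fun r l => PowerSeries.coeff l (F r)) i j = 0) (i : Fin N) :
    PowerSeries.order (reducedSeries k F i) = (k i : ℕ∞) := by
  refine PowerSeries.order_eq_nat.2 ⟨?_, fun j hj => ?_⟩
  · rw [coeff_reducedSeries]
    exact right_ne_zero_of_mul (Finset.prod_ne_zero_iff.1 hF i (Finset.mem_univ _))
  · rw [coeff_reducedSeries]
    by_cases hc : ∀ c < i, j ≠ k c
    · exact h i j hj hc
    · push Not at hc
      obtain ⟨c, hc, rfl⟩ := hc
      exact pivotMinor_pivot hc

theorem spanOrders_of_pivotMinor_eq_zero (hk : Function.Injective k)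
    (hF : pivotProd k (fun r l => PowerSeries.coeff l (F r)) ≠ 0)
    (h : ∀ i, ∀ j < k i, (∀ c < i, j ≠ k c) →
      pivotMinor k (fun r l => PowerSeries.coeff l (F r)) i j = 0) :
    spanOrders (Submodule.span ℂ (Set.range F)) = Set.range k := by
  rw [← span_reducedSeries hF]
  exact spanOrders_span_range hk (order_reducedSeries hF h)

theorem linearIndependent_of_pivotMinor_eq_zero (hk : Function.Injective k)
    (hF : pivotProd k (fun r l => PowerSeries.coeff l (F r)) ≠ 0)
    (h : ∀ i, ∀ j < k i, (∀ c < i, j ≠ k c) →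
      pivotMinor k (fun r l => PowerSeries.coeff l (F r)) i j = 0) :
    LinearIndependent ℂ F := by
  have := linearIndependent_of_order hk (order_reducedSeries hF h)
  rw [linearIndependent_iff_card_eq_finrank_span, Set.finrank] at this ⊢
  rwa [← span_reducedSeries hF]

/-- The reduced series `i`, unless zero, has order some `k c`; its coefficients at the earlier
pivots vanish, which leaves only `c ≥ i`. -/
theorem pivotMinor_eq_zero (hk : StrictMono k)
    (hF : spanOrders (Submodule.span ℂ (Set.range F)) = Set.range k) (i : Fin N) {j : ℕ}
    (hj : j < k i) : pivotMinor k (fun r l => PowerSeries.coeff l (F r)) i j = 0 := by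
  rw [← coeff_reducedSeries]
  by_cases htop : PowerSeries.order (reducedSeries k F i) = ⊤
  · rw [PowerSeries.order_eq_top.1 htop, map_zero]
  obtain ⟨s, hs⟩ := ENat.ne_top_iff_exists.1 htop
  have hmem : s ∈ spanOrders (Submodule.span ℂ (Set.range F)) :=
    ⟨_, Submodule.sum_mem _ fun r _ => Submodule.smul_mem _ _ (Submodule.subset_span ⟨r, rfl⟩),
      hs.symm⟩
  rw [hF] at hmem
  obtain ⟨c, rfl⟩ := hmem
  have hs' := PowerSeries.order_eq_nat.1 hs.symm
  rcases lt_or_ge c i with hc | hc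
  · exact absurd (by rw [coeff_reducedSeries, pivotMinor_pivot hc]) hs'.1
  · exact hs'.2 j (hj.trans_le (hk.monotone hc))

end reduced

theorem pivotProd_eq_one {N : ℕ} {A : Type*} [CommRing A] {k : Fin N → ℕ} {b : Fin N → ℕ → A}
    (hb : ∀ r c, b r (k c) = if r = c then 1 else 0) : pivotProd k b = 1 := by
  have h1 : ∀ i, pivotMatrix k b i = 1 := by
    intro i
    ext r c
    simp [pivotMatrix, hb, Matrix.one_apply]
  refine Finset.prod_eq_one fun i _ => ?_
  have h2 : (1 : Matrix (Fin N) (Fin N) A).updateCol i (fun r => b r (k i)) = 1 := by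
    ext r c
    rw [Matrix.updateCol_apply]
    split_ifs with h
    · rw [hb, h, Matrix.one_apply]
    · rfl
  rw [pivotMinor, h1, h2, Matrix.det_one, mul_one]

/-! ### The germ at `x = 0` as a function of the coefficients of the forms -/

theorem spanOrders_subset {W W' : Submodule ℂ (PowerSeries ℂ)} {u : PowerSeries ℂ}
    (hu : PowerSeries.constantCoeff u ≠ 0) (h : W ≤ W'.comap (LinearMap.mulRight ℂ u)) :
    spanOrders W ⊆ spanOrders W' := by
  rintro s ⟨w, hw, hs⟩
  refine ⟨w * u, h hw, ?_⟩
  have : PowerSeries.order u = ((0 : ℕ) : ℕ∞) :=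
    PowerSeries.order_eq_nat.2 ⟨by simpa using hu, by simp⟩
  rw [PowerSeries.order_mul, hs, this]
  simp

/-- Multiplication by the unit `F 0` carries the span of `1` and the affine coordinates onto the
span of the `F i` and preserves orders. -/
theorem vanishingOrders_affineGerm {n : ℕ} {F : Fin (n + 1) → PowerSeries ℂ}
    (h0 : PowerSeries.constantCoeff (F 0) ≠ 0) :
    vanishingOrders (affineGerm F 0) = spanOrders (Submodule.span ℂ (Set.range F)) := by
  have hC : ∀ c : ℂ, PowerSeries.C c = c • (1 : PowerSeries ℂ) := fun c => by
    rw [PowerSeries.smul_eq_C_mul, mul_one]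
  rw [vanishingOrders_eq]
  have h1 : (1 : PowerSeries ℂ) ∈ Submodule.span ℂ (insert 1 (Set.range (affineGerm F 0))) :=
    Submodule.subset_span (Or.inl rfl)
  apply Set.Subset.antisymm
  · refine spanOrders_subset h0 ?_
    rw [Submodule.span_le]
    rintro _ (rfl | ⟨i, rfl⟩)
    · have : F 0 ∈ Submodule.span ℂ (Set.range F) := Submodule.subset_span ⟨0, rfl⟩
      simpa using this
    · simp only [affineGerm, Fin.zero_succAbove, hC, Submodule.comap_coe, Set.mem_preimage,
        LinearMap.mulRight_apply, SetLike.mem_coe, sub_mul, smul_mul_assoc, one_mul]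
      rw [mul_assoc, PowerSeries.inv_mul_cancel _ h0, mul_one]
      exact sub_mem (Submodule.subset_span ⟨_, rfl⟩)
        (Submodule.smul_mem _ _ (Submodule.subset_span ⟨_, rfl⟩))
  · refine spanOrders_subset (u := (F 0)⁻¹) (by simpa using h0) ?_
    rw [Submodule.span_le]
    rintro _ ⟨i, rfl⟩
    refine Fin.cases ?_ (fun i => ?_) i
    · simpa [PowerSeries.mul_inv_cancel _ h0] using h1
    · have : F i.succ * (F 0)⁻¹ = affineGerm F 0 i +
          PowerSeries.constantCoeff (F i.succ * (F 0)⁻¹) • (1 : PowerSeries ℂ) := by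
        simp [affineGerm, hC]
      simp only [Submodule.comap_coe, Set.mem_preimage, LinearMap.mulRight_apply, SetLike.mem_coe]
      rw [this]
      exact add_mem (Submodule.subset_span (Or.inr ⟨i, rfl⟩)) (Submodule.smul_mem _ _ h1)

/-- The forms in the local parameter `x / y` at the point `x = 0`. -/
noncomputable def rowSeries {n d : ℕ} (a : Coeffs n d) (i : Fin (n + 1)) : PowerSeries ℂ :=
  PowerSeries.mk fun l => if h : l < d + 1 then a (i, ⟨l, h⟩) else 0

theorem expansion_eq_rowSeries {n d : ℕ} (a : Coeffs n d) :
    expansion a ![0, 1] ![1, 0] = rowSeries a := by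
  funext i
  ext l
  simp only [expansion, formEval, rowSeries, PowerSeries.coeff_mk, Matrix.cons_val_zero,
    Matrix.cons_val_one, map_zero, map_one, zero_add, one_smul, zero_smul, add_zero, one_pow,
    mul_one, map_sum, PowerSeries.coeff_smul, PowerSeries.coeff_X_pow, smul_eq_mul, mul_ite,
    mul_zero]
  split_ifs with h
  · rw [Finset.sum_eq_single ⟨l, h⟩]
    · simp
    · intro j _ hj
      rw [if_neg]
      rintro rfl
      exact hj rfl
    · simp
  · refine Finset.sum_eq_zero fun j _ => if_neg ?_
    have := j.2
    omega

theorem constantCoeff_rowSeries {n d : ℕ} (a : Coeffs n d) (i : Fin (n + 1)) :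
    PowerSeries.constantCoeff (rowSeries a i) = a (i, 0) := by
  rw [← PowerSeries.coeff_zero_eq_constantCoeff_apply, rowSeries, PowerSeries.coeff_mk]
  simp

/-- A function of the coefficients that is a polynomial divided by a power of the constant term of
the first form. -/
def IsRational {n d : ℕ} (φ : Coeffs n d → ℂ) : Prop :=
  ∃ (h : MvPolynomial (Fin (n + 1) × Fin (d + 1)) ℂ) (M : ℕ), ∀ a : Coeffs n d, a (0, 0) ≠ 0 →
    φ a * a (0, 0) ^ M = MvPolynomial.eval a h

section rational

variable {n d : ℕ}

theorem IsRational.const (c : ℂ) : IsRational fun _ : Coeffs n d => c :=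
  ⟨MvPolynomial.C c, 0, by simp⟩

theorem IsRational.coeff (v : Fin (n + 1) × Fin (d + 1)) : IsRational fun a : Coeffs n d => a v :=
  ⟨MvPolynomial.X v, 0, by simp⟩

theorem IsRational.inv : IsRational fun a : Coeffs n d => (a (0, 0))⁻¹ :=
  ⟨1, 1, fun a ha => by simp [ha]⟩

theorem IsRational.mul {φ ψ : Coeffs n d → ℂ} (hφ : IsRational φ) (hψ : IsRational ψ) :
    IsRational fun a => φ a * ψ a := by
  obtain ⟨h, M, hM⟩ := hφ
  obtain ⟨h', M', hM'⟩ := hψ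
  refine ⟨h * h', M + M', fun a ha => ?_⟩
  rw [map_mul, ← hM a ha, ← hM' a ha]
  ring

theorem IsRational.add {φ ψ : Coeffs n d → ℂ} (hφ : IsRational φ) (hψ : IsRational ψ) :
    IsRational fun a => φ a + ψ a := by
  obtain ⟨h, M, hM⟩ := hφ
  obtain ⟨h', M', hM'⟩ := hψ
  refine ⟨h * MvPolynomial.X (0, 0) ^ M' + h' * MvPolynomial.X (0, 0) ^ M, M + M', fun a ha => ?_⟩
  rw [map_add, map_mul, map_mul, ← hM a ha, ← hM' a ha]
  simp only [map_pow, MvPolynomial.eval_X]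
  ring

theorem IsRational.sum {ι : Type*} (s : Finset ι) {φ : ι → Coeffs n d → ℂ}
    (h : ∀ i ∈ s, IsRational (φ i)) : IsRational fun a => ∑ i ∈ s, φ i a := by
  classical
  induction s using Finset.induction_on with
  | empty => simpa using IsRational.const 0
  | insert i s hi ih =>
    simp only [Finset.sum_insert hi]
    exact (h i (Finset.mem_insert_self _ _)).add
      (ih fun j hj => h j (Finset.mem_insert_of_mem hj))

theorem IsRational.coeff_rowSeries (i : Fin (n + 1)) (l : ℕ) :
    IsRational fun a : Coeffs n d => PowerSeries.coeff l (rowSeries a i) := by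
  simp only [rowSeries, PowerSeries.coeff_mk]
  split_ifs with h
  · exact IsRational.coeff _
  · exact IsRational.const 0

theorem IsRational.coeff_rowSeries_inv (l : ℕ) :
    IsRational fun a : Coeffs n d => PowerSeries.coeff l (rowSeries a 0)⁻¹ := by
  induction l using Nat.strong_induction_on with
  | _ l ih =>
    have e : (fun a : Coeffs n d => PowerSeries.coeff l (rowSeries a 0)⁻¹) = fun a =>
        if l = 0 then (a (0, 0))⁻¹ else (-1) * ((a (0, 0))⁻¹ *
          ∑ x ∈ Finset.HasAntidiagonal.antidiagonal l, if x.2 < l then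
            PowerSeries.coeff x.1 (rowSeries a 0) *
              PowerSeries.coeff x.2 (rowSeries a 0)⁻¹ else 0) :=
      funext fun a => by
        rw [PowerSeries.coeff_inv, constantCoeff_rowSeries, neg_mul, neg_one_mul]
    rw [e]
    split_ifs with hl
    · exact IsRational.inv
    · refine (IsRational.const (-1)).mul (IsRational.inv.mul (IsRational.sum _ fun x _ => ?_))
      split_ifs with hx
      · exact (IsRational.coeff_rowSeries _ _).mul (ih _ hx)
      · exact IsRational.const 0

theorem IsRational.coeff_affineGerm (i : Fin n) (l : ℕ) :
    IsRational fun a : Coeffs n d => PowerSeries.coeff l (affineGerm (rowSeries a) 0 i) := by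
  have h : ∀ l, IsRational fun a : Coeffs n d =>
      PowerSeries.coeff l (rowSeries a i.succ * (rowSeries a 0)⁻¹) := by
    intro l
    simp only [PowerSeries.coeff_mul]
    exact IsRational.sum _ fun x _ =>
      (IsRational.coeff_rowSeries _ _).mul (IsRational.coeff_rowSeries_inv _)
  simp only [affineGerm, Fin.zero_succAbove, map_sub, PowerSeries.coeff_C]
  split_ifs with hl
  · simp only [← PowerSeries.coeff_zero_eq_constantCoeff_apply, sub_eq_add_neg,
      ← neg_one_mul (PowerSeries.coeff 0 _)]
    exact (h l).add ((IsRational.const (-1)).mul (h 0))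
  · simpa using h l

/-- It turns the genericity condition on the affine germ into the nonvanishing of a polynomial in
the coefficients of the forms, where `a (0, 0) ≠ 0`. -/
theorem IsRational.evalCoeffs (Q : MvPolynomial (Fin n × ℕ) ℂ) :
    IsRational fun a : Coeffs n d => evalCoeffs Q (affineGerm (rowSeries a) 0) := by
  induction Q using MvPolynomial.induction_on with
  | C c => simpa [SeveriGen.evalCoeffs] using IsRational.const c
  | add p q hp hq => simpa [SeveriGen.evalCoeffs] using hp.add hq
  | mul_X p v hp =>
    simpa [SeveriGen.evalCoeffs] using hp.mul (IsRational.coeff_affineGerm v.1 v.2)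

end rational

/-! ### Codimension of the Severi variety of a generic cusp -/

/-- The equations of the space of forms with ramification profile `k` at the point `x = 0`. -/
def PivotEquations {N : ℕ} (k : Fin N → ℕ) (F : Fin N → PowerSeries ℂ) : Prop :=
  ∀ i, ∀ j < k i, (∀ c < i, j ≠ k c) →
    pivotMinor k (fun r l => PowerSeries.coeff l (F r)) i j = 0

theorem insert_zero_range {n : ℕ} (k : Fin n → ℕ) :
    insert 0 (Set.range k) = Set.range (Fin.cons 0 k : Fin (n + 1) → ℕ) := by
  rw [Fin.range_cons]

theorem cons_strictMono {n : ℕ} {k : Fin n → ℕ} (hk : StrictMono k) (hpos : ∀ i, 0 < k i) :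
    StrictMono (Fin.cons 0 k : Fin (n + 1) → ℕ) := by
  intro i j
  refine Fin.cases ?_ (fun i => ?_) i <;> refine Fin.cases ?_ (fun j => ?_) j
  · simp
  · simpa using hpos j
  · simp
  · simpa using fun h => hk h

theorem IsGenericOver.mem_severiVariety {n d : ℕ} (hn : 3 ≤ n) {k : Fin n → ℕ}
    (hk : StrictMono k) (hpos : ∀ i, 0 < k i) {S : Set ℕ} (hS : S ≠ Set.univ)
    {Q : MvPolynomial (Fin n × ℕ) ℂ}
    (hQ : ∀ f, HasRamificationProfile f k → evalCoeffs Q f ≠ 0 → valueSemigroup f = S)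
    {a : Coeffs n d} {K : Subfield ℂ} {x : Fin (n + 1) ⊕ Fin (n + 1) → ℂ}
    (ha : IsGenericOver a K x) (h0 : a (0, 0) ≠ 0)
    (hprod : pivotProd (Fin.cons 0 k) (fun r l => PowerSeries.coeff l (rowSeries a r)) ≠ 0)
    (heq : PivotEquations (Fin.cons 0 k) (rowSeries a))
    (hQa : evalCoeffs Q (affineGerm (rowSeries a) 0) ≠ 0) :
    a ∈ severiVariety n d S := by
  have hinj := (cons_strictMono hk hpos).injective
  have hbpf : BasePointFree a := ha.basePointFree hn ⟨0, h0⟩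
  refine ⟨⟨hbpf, ?_⟩, hS, hbpf, ha.injective hn hbpf, ?_⟩
  · have hli := linearIndependent_of_pivotMinor_eq_zero hinj hprod heq
    rw [Fintype.linearIndependent_iff] at hli ⊢
    intro c hc
    refine hli c ?_
    ext l
    rw [map_sum, map_zero]
    simp only [PowerSeries.coeff_smul, rowSeries, PowerSeries.coeff_mk, smul_eq_mul]
    split_ifs with h
    · simpa using congrFun hc ⟨l, h⟩
    · simp
  have hp : (![0, 1] : Fin 2 → ℂ) ≠ 0 := fun h => by simpa using congrFun h 1
  refine ⟨Projectivization.mk ℂ ![0, 1] hp, ⟨![0, 1], ![1, 0], hp, 0, rfl, ?_, ?_, ?_⟩, ?_⟩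
  · rw [LinearIndependent.pair_iff]
    intro s t hst
    exact ⟨by simpa using congrFun hst 1, by simpa using congrFun hst 0⟩
  · simpa [formEval_zero_one] using h0
  · rw [expansion_eq_rowSeries]
    refine hQ _ ⟨constantCoeff_affineGerm _ _, ?_⟩ hQa
    rw [vanishingOrders_affineGerm (by rwa [constantCoeff_rowSeries]), insert_zero_range]
    exact spanOrders_of_pivotMinor_eq_zero hinj hprod heq
  · intro q hq
    rcases point_cases q with ⟨y, h, rfl⟩ | ⟨h, rfl⟩
    · exact ha.hasValueSemigroupAt_univ hn hbpf y h
    · exact absurd rfl hq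

/-- The coefficients of the universal forms. -/
noncomputable def universalCoeff (n d : ℕ) (r : Fin (n + 1)) (l : ℕ) :
    MvPolynomial (Fin (n + 1) × Fin (d + 1)) ℂ :=
  if h : l < d + 1 then MvPolynomial.X (r, ⟨l, h⟩) else 0

theorem eval_universalCoeff {n d : ℕ} (a : Coeffs n d) (r : Fin (n + 1)) (l : ℕ) :
    MvPolynomial.eval a (universalCoeff n d r l) = PowerSeries.coeff l (rowSeries a r) := by
  rw [universalCoeff, rowSeries, PowerSeries.coeff_mk]
  split_ifs <;> simp

/-- For the monomials `t ^ k i` all the pivot minors equal `1`, so their nonvanishing is a nonempty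
open condition, compatible with `Q ≠ 0` by irreducibility. -/
theorem exists_pivotProd_ne_zero {n : ℕ} {k : Fin n → ℕ} (hk : Function.Injective k)
    (hpos : ∀ i, 0 < k i) {Q : MvPolynomial (Fin n × ℕ) ℂ} {f₀ : Fin n → PowerSeries ℂ}
    (hf₀ : HasRamificationProfile f₀ k) (hQ : evalCoeffs Q f₀ ≠ 0) :
    ∃ f, HasRamificationProfile f k ∧ evalCoeffs Q f ≠ 0 ∧
      pivotProd (Fin.cons 0 k) (fun r l => PowerSeries.coeff l
        ((Fin.cons 1 f : Fin (n + 1) → PowerSeries ℂ) r)) ≠ 0 := by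
  let b : Fin (n + 1) → ℕ → MvPolynomial (Fin n × ℕ) ℂ := fun r l =>
    (Fin.cons (if l = 0 then 1 else 0) (fun i => MvPolynomial.X (i, l)) :
      Fin (n + 1) → MvPolynomial (Fin n × ℕ) ℂ) r
  have hb : ∀ f, evalCoeffs (pivotProd (Fin.cons 0 k) b) f =
      pivotProd (Fin.cons 0 k) (fun r l => PowerSeries.coeff l
        ((Fin.cons 1 f : Fin (n + 1) → PowerSeries ℂ) r)) := by
    intro f
    rw [evalCoeffs, map_pivotProd]
    congr 1
    funext r l
    refine Fin.cases ?_ (fun i => ?_) r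
    · simp only [b, Fin.cons_zero, PowerSeries.coeff_one]
      split_ifs <;> simp
    · simp [b]
  have hf₁ : HasRamificationProfile (fun i => (PowerSeries.X : PowerSeries ℂ) ^ k i) k :=
    hasRamificationProfile_of_order hk hpos fun i => PowerSeries.order_X_pow _
  obtain ⟨f, hf, h⟩ := exists_evalCoeffs_mul_ne_zero hk hpos
    (Q₂ := pivotProd (Fin.cons 0 k) b) hf₀ hf₁ hQ (by
      rw [hb, pivotProd_eq_one]
      · exact one_ne_zero
      · intro r c
        refine Fin.cases ?_ (fun i => ?_) r <;> refine Fin.cases ?_ (fun j => ?_) c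
        · simp
        · simp [PowerSeries.coeff_one, (hpos j).ne', (Fin.succ_ne_zero j).symm]
        · simp [PowerSeries.coeff_X_pow, (hpos i).ne]
        · simp [PowerSeries.coeff_X_pow, hk.eq_iff, eq_comm])
  rw [evalCoeffs, map_mul, mul_ne_zero_iff] at h
  exact ⟨f, hf, h.1, hb f ▸ h.2⟩

/-- The pairs indexing the equations of the space of forms with ramification profile `k`. -/
def equationIndices {N : ℕ} (k : Fin N → ℕ) : Finset (Σ _ : Fin N, ℕ) :=
  Finset.univ.sigma fun i => Finset.range (k i) \ (Finset.Iio i).image k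

/-- Row `i` has one equation for each column before its pivot `k i`, except the `i` earlier pivot
columns, where the minor vanishes identically. -/
theorem card_equationIndices {N : ℕ} {k : Fin N → ℕ} (hk : StrictMono k) :
    (equationIndices k).card = ∑ i, (k i - i) := by
  rw [equationIndices, Finset.card_sigma]
  refine Finset.sum_congr rfl fun i _ => ?_
  rw [Finset.card_sdiff_of_subset, Finset.card_range, Finset.card_image_of_injective _ hk.injective,
    Fin.card_Iio]
  intro j hj
  obtain ⟨c, hc, rfl⟩ := Finset.mem_image.1 hj
  exact Finset.mem_range.2 (hk (Finset.mem_Iio.1 hc))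

theorem exists_finset_pivotEquations {n d : ℕ} {k : Fin (n + 1) → ℕ} (hk : StrictMono k) :
    ∃ s : Finset (MvPolynomial (Fin (n + 1) × Fin (d + 1)) ℂ), s.card ≤ ∑ i, (k i - i) ∧
      ∀ a : Coeffs n d, (∀ p ∈ s, MvPolynomial.eval a p = 0) ↔ PivotEquations k (rowSeries a) := by
  classical
  refine ⟨(equationIndices k).image fun q => pivotMinor k (universalCoeff n d) q.1 q.2,
    Finset.card_image_le.trans (card_equationIndices hk).le, fun a => ?_⟩
  simp only [Finset.forall_mem_image, map_pivotMinor, eval_universalCoeff, PivotEquations]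
  constructor
  · intro h i j hj hc
    refine h (x := ⟨i, j⟩) ?_
    simp only [equationIndices, Finset.mem_sigma, Finset.mem_univ, true_and, Finset.mem_sdiff,
      Finset.mem_range, Finset.mem_image, Finset.mem_Iio, not_exists, not_and]
    exact ⟨hj, fun c hci e => hc c hci e.symm⟩
  · rintro h ⟨i, j⟩ hq
    simp only [equationIndices, Finset.mem_sigma, Finset.mem_univ, true_and, Finset.mem_sdiff,
      Finset.mem_range, Finset.mem_image, Finset.mem_Iio, not_exists, not_and] at hq
    exact h i j hq.1 fun c hc e => hq.2 c hc e.symm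

/-- The forms with the last two coefficients replaced. -/
def replaceLast {n d : ℕ} {A : Type*} (a : Fin (n + 1) × Fin (d + 1) → A)
    (x : Fin (n + 1) ⊕ Fin (n + 1) → A) : Fin (n + 1) × Fin (d + 1) → A :=
  fun v => if (v.2 : ℕ) = d then x (Sum.inl v.1) else
    if (v.2 : ℕ) = d - 1 then x (Sum.inr v.1) else a v

theorem eval_aeval_replaceLast {n d : ℕ} (a : Coeffs n d) (x : Fin (n + 1) ⊕ Fin (n + 1) → ℂ)
    (p : MvPolynomial (Fin (n + 1) × Fin (d + 1)) ℂ) :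
    MvPolynomial.eval x (MvPolynomial.aeval
      (replaceLast (fun v => MvPolynomial.C (a v)) MvPolynomial.X) p) =
      MvPolynomial.eval (replaceLast a x) p := by
  rw [MvPolynomial.aeval_def, MvPolynomial.hom_eval₂, ← MvPolynomial.coe_eval₂Hom,
    MvPolynomial.eval]
  congr 2
  · ext c
    simp
  · funext v
    simp only [replaceLast]
    split_ifs <;> simp

theorem replaceLast_self {n d : ℕ} (hd : 2 ≤ d) (a : Coeffs n d) :
    replaceLast a (Sum.elim (fun i => a (i, Fin.last d)) fun i => a (i, ⟨d - 1, by omega⟩)) = a := by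
  funext v
  obtain ⟨i, j⟩ := v
  simp only [replaceLast]
  split_ifs with h1 h2
  · obtain rfl : j = Fin.last d := Fin.ext h1
    rfl
  · exact congrArg (fun j => a (i, j)) (Fin.ext h2.symm)
  · rfl

theorem coeff_rowSeries_replaceLast {n d : ℕ} (a : Coeffs n d)
    (x : Fin (n + 1) ⊕ Fin (n + 1) → ℂ) (r : Fin (n + 1)) {l : ℕ} (hl : l < d - 1) :
    PowerSeries.coeff l (rowSeries (replaceLast a x) r) = PowerSeries.coeff l (rowSeries a r) := by
  simp only [rowSeries, PowerSeries.coeff_mk, replaceLast]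
  split_ifs with h1 h2 h3
  · omega
  · omega
  · rfl
  · rfl

theorem isGenericOver_replaceLast {n d : ℕ} (hd : 2 ≤ d) {a : Coeffs n d} {K : Subfield ℂ}
    {x : Fin (n + 1) ⊕ Fin (n + 1) → ℂ} (hx : AlgebraicIndependent K x) (ha : ∀ v, a v ∈ K) :
    IsGenericOver (replaceLast a x) K x where
  two_le := hd
  indep := hx
  mem i j hj := by
    rw [replaceLast, if_neg (by dsimp only; omega), if_neg (by dsimp only; omega)]
    exact ha _
  last i := by simp [replaceLast]
  penult i := by
    rw [replaceLast, if_neg (by dsimp only; omega), if_pos rfl]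

/-- A polynomial vanishing at the forms with generic last two coefficients vanishes. -/
theorem eval_eq_zero_of_generic {n d : ℕ} (hd : 2 ≤ d) {a : Coeffs n d}
    {h H : MvPolynomial (Fin (n + 1) × Fin (d + 1)) ℂ} (hh : MvPolynomial.eval a h ≠ 0)
    (hH : ∀ (K : Subfield ℂ) (x : Fin (n + 1) ⊕ Fin (n + 1) → ℂ), AlgebraicIndependent K x →
      (∀ v, a v ∈ K) → MvPolynomial.eval (replaceLast a x) h ≠ 0 →
        MvPolynomial.eval (replaceLast a x) H = 0) :
    MvPolynomial.eval a H = 0 := by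
  by_contra hHa
  let θ : MvPolynomial (Fin (n + 1) × Fin (d + 1)) ℂ →ₐ[ℂ]
      MvPolynomial (Fin (n + 1) ⊕ Fin (n + 1)) ℂ :=
    MvPolynomial.aeval (replaceLast (fun v => MvPolynomial.C (a v)) MvPolynomial.X)
  have hθ : θ (h * H) ≠ 0 := by
    intro h0
    have := eval_aeval_replaceLast a
      (Sum.elim (fun i => a (i, Fin.last d)) fun i => a (i, ⟨d - 1, by omega⟩)) (h * H)
    rw [replaceLast_self hd] at this
    change MvPolynomial.eval _ (θ (h * H)) = _ at this
    rw [h0, map_zero, map_mul] at this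
    exact mul_ne_zero hh hHa this.symm
  obtain ⟨K, hZK, x, hx, hxH⟩ := exists_algebraicIndependent (θ (h * H)) hθ (Set.range a)
    (Set.countable_range a)
  rw [eval_aeval_replaceLast, map_mul, mul_ne_zero_iff] at hxH
  exact hxH.2 (hH K x hx (fun v => hZK ⟨v, rfl⟩) hxH.1)

/-- For large degree, the codimension of the Severi variety of a generic cusp is at most that of
the space of germs with the given ramification profile. -/
theorem exists_codimension_le {n : ℕ} (hn : 3 ≤ n) {k : Fin n → ℕ} (hk : StrictMono k)
    (hpos : ∀ i, 0 < k i) {S : Set ℕ} (hS : IsGenericValueSemigroup k S) (hne : S ≠ Set.univ) :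
    ∃ N : ℕ, ∀ d : ℕ, N ≤ d → codimension (morphismSpace n d) (severiVariety n d S) ≤
      ((∑ i : Fin n, (k i - ((i : ℕ) + 1)) : ℕ) : ℕ∞) := by
  classical
  obtain ⟨Q, ⟨f₀, hf₀, hQf₀⟩, hQ⟩ := hS
  obtain ⟨f, hf, hQf, hprod⟩ := exists_pivotProd_ne_zero hk.injective hpos hf₀ hQf₀
  have hk' := cons_strictMono hk hpos
  set k' : Fin (n + 1) → ℕ := Fin.cons 0 k with hk'def
  -- The threshold makes all pivots and all coefficients occurring in `Q` have index at most `d -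
  -- 2`, out of reach of the last two coefficients.
  refine ⟨(∑ i, k' i) + (∑ v ∈ Q.vars, v.2) + 2, fun d hd => ?_⟩
  have hkd : ∀ i, k' i ≤ d - 2 := fun i => by
    have := Finset.single_le_sum (f := k') (fun _ _ => Nat.zero_le _) (Finset.mem_univ i)
    omega
  have hQd : ∀ v ∈ Q.vars, v.2 ≤ d - 2 := fun v hv => by
    have := Finset.single_le_sum (f := fun v : Fin n × ℕ => v.2) (fun _ _ => Nat.zero_le _) hv
    omega
  obtain ⟨hQ', M, hM⟩ := IsRational.evalCoeffs (d := d) Q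
  obtain ⟨s, hcard, hs⟩ := exists_finset_pivotEquations (d := d) hk'
  obtain ⟨h, hh⟩ : ∃ h : MvPolynomial (Fin (n + 1) × Fin (d + 1)) ℂ, ∀ a : Coeffs n d,
      MvPolynomial.eval a h ≠ 0 ↔ a (0, 0) ≠ 0 ∧
        pivotProd k' (fun r l => PowerSeries.coeff l (rowSeries a r)) ≠ 0 ∧
        evalCoeffs Q (affineGerm (rowSeries a) 0) ≠ 0 := by
    refine ⟨MvPolynomial.X (0, 0) * pivotProd k' (universalCoeff n d) * hQ', fun a => ?_⟩
    simp only [map_mul, map_pivotProd, eval_universalCoeff, MvPolynomial.eval_X,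
      mul_ne_zero_iff, and_assoc]
    refine and_congr_right fun h0 => and_congr_right fun _ => ?_
    rw [← hM a h0, mul_ne_zero_iff, and_iff_left (pow_ne_zero _ h0)]
  -- The forms `1, f₁, …, fₙ` truncated at degree `d`, a point where all the open conditions hold.
  let a₀ : Coeffs n d := fun v =>
    PowerSeries.coeff (v.2 : ℕ) ((Fin.cons 1 f : Fin (n + 1) → PowerSeries ℂ) v.1)
  have ha₀ : ∀ r, ∀ l ≤ d, PowerSeries.coeff l (rowSeries a₀ r) =
      PowerSeries.coeff l ((Fin.cons 1 f : Fin (n + 1) → PowerSeries ℂ) r) := by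
    intro r l hl
    rw [rowSeries, PowerSeries.coeff_mk, dif_pos (by omega)]
  have hspan : spanOrders (Submodule.span ℂ (Set.range
      (Fin.cons 1 f : Fin (n + 1) → PowerSeries ℂ))) = Set.range k' := by
    rw [← span_insert_range_eq, ← vanishingOrders_eq, hf.2, insert_zero_range]
  have hcard' : (s.card : ℕ∞) ≤ ((∑ i : Fin n, (k i - ((i : ℕ) + 1)) : ℕ) : ℕ∞) := by
    rw [Fin.sum_univ_succ] at hcard
    simp only [hk'def, Fin.cons_zero, Fin.cons_succ, Fin.val_succ, Nat.zero_sub, zero_add] at hcard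
    exact_mod_cast hcard
  refine (codimension_le_card (fun a ha => ha.1) s h a₀ ((hs a₀).2 ?_) ((hh a₀).2 ⟨?_, ?_, ?_⟩)
    ?_).trans hcard'
  · intro i j hj _
    rw [pivotMinor_congr (fun i => (hkd i).trans (Nat.sub_le d 2)) ha₀ i
      (hj.le.trans ((hkd i).trans (Nat.sub_le d 2)))]
    exact pivotMinor_eq_zero hk' hspan i hj
  · simp [a₀]
  · rwa [pivotProd_congr (fun i => (hkd i).trans (Nat.sub_le d 2)) ha₀]
  · have h1 : rowSeries a₀ 0 = 1 := by
      ext l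
      simp [rowSeries, a₀, PowerSeries.coeff_one]
      omega
    have h2 : evalCoeffs Q (affineGerm (rowSeries a₀) 0) = evalCoeffs Q f := by
      rw [evalCoeffs, evalCoeffs]
      refine MvPolynomial.eval₂Hom_congr' rfl (fun v hv _ => ?_) rfl
      have h3 := ha₀ v.1.succ v.2 ((hQd v hv).trans (Nat.sub_le d 2))
      have h4 : PowerSeries.constantCoeff (rowSeries a₀ v.1.succ) = 0 := by
        rw [constantCoeff_rowSeries]
        simpa [a₀] using hf.1 v.1
      rw [Fin.cons_succ] at h3
      rw [← h3]
      simp [affineGerm, h1, h4]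
    rwa [h2]
  · intro a ha hha H hH
    -- Replacing the last two coefficients by generic ones preserves the equations and puts the
    -- forms in the Severi variety, so `H` vanishes there; it then vanishes at `a` as well.
    have hd2 : 2 ≤ d := by omega
    refine eval_eq_zero_of_generic hd2 hha fun K x hx haK hxh => ?_
    have hgen := isGenericOver_replaceLast hd2 hx (a := a) haK
    obtain ⟨h1, h2, h3⟩ := (hh _).1 hxh
    have heq : PivotEquations k' (rowSeries (replaceLast a x)) := by
      intro i j hj hc
      rw [pivotMinor_congr (d := d - 2) hkd
        (fun r l hl => coeff_rowSeries_replaceLast a x r (by omega)) i (hj.le.trans (hkd i))]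
      exact (hs a).1 ha i j hj hc
    have := (MvPolynomial.mem_vanishingIdeal_iff.1 hH) _
      (hgen.mem_severiVariety hn hk hpos hne hQ h1 h2 heq h3)
    simpa using this

/-! ### Conclusion for even profiles -/

theorem evenProfile_strictMono (n m : ℕ) : StrictMono (evenProfile n m) := by
  intro i j h
  simp only [evenProfile]
  have : (i : ℕ) < j := h
  omega

/-- The generic value semigroup for an even profile, and the codimension of its Severi variety. -/
theorem exists_generic_codimension_lt {n m : ℕ} (hn : 4 ≤ n)
    (hm : (7 / 6 : ℝ) * n + 26 / 9 < m) :
    ∃ S : Set ℕ, (∀ S', IsGenericValueSemigroup (evenProfile n m) S' ↔ S' = S) ∧ Sᶜ.Finite ∧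
      n ≤ Sᶜ.ncard ∧ m ≤ Sᶜ.ncard ∧
      ∃ N : ℕ, ∀ d, N ≤ d → codimension (morphismSpace n d) (severiVariety n d S) <
        (((n - 2) * Sᶜ.ncard : ℕ) : ℕ∞) := by
  have hnm : n + 1 ≤ m := by
    have : (n : ℝ) < m := by
      have : (0 : ℝ) ≤ n := n.cast_nonneg
      linarith
    exact_mod_cast this
  have hm0 : 0 < m := by omega
  obtain ⟨f₀, hf₀, hfin₀⟩ := exists_evenProfile_finite_compl (n := n) (m := m) (by omega) hm0
  obtain ⟨S, hS, hfin, f, hf, rfl⟩ := exists_isGenericValueSemigroup (evenProfile_injective n m)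
    (evenProfile_pos hm0) hf₀ hfin₀
  have h1 := evenProfile_linear_gaps hf hfin
  have h2 := evenProfile_quadratic_gaps (by omega) hm0 hf hfin
  have hlt := sum_evenProfile_lt hn hm h1 h2
  have hne : valueSemigroup f ≠ Set.univ := by
    intro h
    rw [h, Set.compl_univ, Set.ncard_empty] at h1
    omega
  obtain ⟨N, hN⟩ := exists_codimension_le (by omega) (evenProfile_strictMono n m)
    (evenProfile_pos hm0) ((hS _).2 rfl) hne
  exact ⟨_, hS, hfin, by omega, by omega, N, fun d hd => (hN d hd).trans_lt (by exact_mod_cast hlt)⟩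

end SeveriGen

theorem corollary3p15 :
    ∃ D : ℕ → ℕ, ∀ n m : ℕ, 4 ≤ n → (7 / 6 : ℝ) * n + 26 / 9 < m →
      ∃ S : Set ℕ,
        (∀ S' : Set ℕ,
          SeveriGen.IsGenericValueSemigroup (SeveriGen.evenProfile n m) S' ↔ S' = S) ∧
        Sᶜ.Finite ∧
        ∀ g : ℕ, g = Sᶜ.ncard → ∀ d : ℕ, D g ≤ d →
          SeveriGen.codimension (SeveriGen.morphismSpace n d) (SeveriGen.severiVariety n d S) <
            (((n - 2) * g : ℕ) : ℕ∞) := by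
  classical
  choose S hS hfin hn' hm' N hN using fun (n m : ℕ) (hn : 4 ≤ n)
    (hm : (7 / 6 : ℝ) * n + 26 / 9 < m) => SeveriGen.exists_generic_codimension_lt hn hm
  let N' : ℕ × ℕ → ℕ := fun q =>
    if h : 4 ≤ q.1 ∧ (7 / 6 : ℝ) * q.1 + 26 / 9 < q.2 then N q.1 q.2 h.1 h.2 else 0
  -- As `n, m ≤ g`, the sum over all pairs up to `g` dominates the threshold of every profile with
  -- this `g`; pairs outside the hypotheses contribute `0`.
  refine ⟨fun g => ∑ q ∈ Finset.range (g + 1) ×ˢ Finset.range (g + 1), N' q, fun n m hn hm =>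
    ⟨S n m hn hm, hS n m hn hm, hfin n m hn hm, ?_⟩⟩
  rintro g rfl d hd
  refine hN n m hn hm d (le_trans ?_ hd)
  have hmem : (n, m) ∈ Finset.range ((S n m hn hm)ᶜ.ncard + 1) ×ˢ
      Finset.range ((S n m hn hm)ᶜ.ncard + 1) := by
    rw [Finset.mem_product, Finset.mem_range, Finset.mem_range]
    exact ⟨Nat.lt_succ_of_le (hn' n m hn hm), Nat.lt_succ_of_le (hm' n m hn hm)⟩
  have := Finset.single_le_sum (f := N') (fun _ _ => Nat.zero_le _) hmem
  have e : N' (n, m) = N n m hn hm := dif_pos ⟨hn, hm⟩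
  rwa [e] at this
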